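/- Words are written over finite alphabets; an infinite word over $\mathcal{A}$ is an element of $\mathcal{A}^{\mathbb{N}}$, and it is called $d$-ary if $\mathcal{A}$ has $d$ letters. Let $\mathcal{L}_n(w)$ be the set of factors (blocks of consecutive letters) of length $n$ of an infinite word $w$. The subword complexity of $w$ is $p_w(n)=\#\mathcal{L}_n(w)$, and $w$ is Sturmian if $p_w(n)=n+1$ for all $n\in\mathbb{N}$. For finite words $u,x$, let $\binom{u}{x}$ be the number of occurrences of $x$ in $u$ as a scattered (not necessarily contiguous) subword; write $u\sim_2 v$ if $\binom{u}{x}=\binom{v}{x}$ for every word $x$ of length at most $2$. The $2$-binomial complexity of $w$ is $b^2_w(n)=\#\big(\mathcal{L}_n(w)/_{\sim_2}\big)$. The word $w$ is $1$-balanced if, for any two factors of $w$ of the same length and any letter $a$, the numbers of occurrences of $a$ in them differ by at most $1$. A hypercubic billiard word in dimension $d$ with initial momentum $\theta\in\mathbb{R}^d\setminus\{0\}$ and initial position $x\in[0,1]^d$ is the infinite word over $\{1,\ldots,d\}$ that lists the labels of the hyperfaces successively hit by a billiard ball moving in the unit hypercube $[0,1]^d$, where the two hyperfaces orthogonal to the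 $i$-th axis are labeled $i$; hyperfaces hit at the same instant (at an edge or a corner) are listed one after the other, following an order on the labels which is fixed for the whole motion. Given infinite words $w_0\in\mathcal{A}^{\mathbb{N}}$ and $w_1\in\mathcal{B}^{\mathbb{N}}$ over disjoint alphabets and a letter $a\in\mathcal{A}$, the coloring $\mathtt{color}(w_0,a,w_1)\in(\mathcal{A}\sqcup\mathcal{B}\setminus\{a\})^{\mathbb{N}}$ is obtained from $w_0$ by replacing, for each $k\geq 1$, the $k$-th occurrence of $a$ by the $k$-th letter of $w_1$. **Theorem.** Let $d\geq 2$. (i) If $w$ is a $1$-balanced $d$-ary infinite word, then $b^2_w=p_w$. (ii) If $w$ is an infinite word with $p_w(n)=n+(d-1)$ for every $n\geq 1$, then $b^2_w=p_w$. (iii) If $w$ is a hypercubic billiard word in dimension $d$, with any initial momentum $\theta\neq 0$ and any initial position $x\in[0,1]^d$, then $b^2_w=p_w$. (iv) If $w=\mathtt{color}(w_0,a,w_1)$, where $w_0$ and $w_1$ are Sturmian words over disjoint alphabets and $a$ is a letter of the alphabet of $w_0$, then $b^2_w=p_w$. -/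

import Mathlib

universe u v

namespace WordComb

section Complexity

variable {A : Type*}

/-- The factor of length `n` starting at position `i` (positions start at `0`) of the infinite
word `w`. -/
def factorAt (w : ℕ → A) (i n : ℕ) : List A :=
  List.ofFn fun j : Fin n => w (i + j)

/-- The set of factors of length `n` of the infinite word `w`. -/
def factors (w : ℕ → A) (n : ℕ) : Set (List A) :=
  {u | ∃ i, u = factorAt w i n}

/-- The subword complexity of `w`: the number of its distinct factors of length `n`. -/
noncomputable def subwordComplexity (w : ℕ → A) (n : ℕ) : ℕ :=
  (factors w n).ncard

/-- An infinite word is Sturmian when its subword complexity is `n ↦ n + 1`. -/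
def IsSturmian (w : ℕ → A) : Prop :=
  ∀ n, subwordComplexity w n = n + 1

variable [DecidableEq A]

/-- The binomial coefficient of words: the number of occurrences of `x` in `u` as a scattered
subword. The list `u.sublists` has one entry for each set of positions of `u`. -/
def binom (u x : List A) : ℕ :=
  u.sublists.count x

/-- `k`-binomial equivalence: the same number of scattered occurrences of every word of length
at most `k`. -/
def kBinomialSetoid (A : Type*) [DecidableEq A] (k : ℕ) : Setoid (List A) where
  r u v := ∀ x : List A, x.length ≤ k → binom u x = binom v x
  iseqv :=
    { refl := fun _ _ _ => rfl
      symm := fun h x hx => (h x hx).symm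
      trans := fun h h' x hx => (h x hx).trans (h' x hx) }

/-- The `k`-binomial complexity of `w`: the number of `k`-binomial classes of its factors of
length `n`. -/
noncomputable def kBinomialComplexity (k : ℕ) (w : ℕ → A) (n : ℕ) : ℕ :=
  (Quotient.mk (kBinomialSetoid A k) '' factors w n).ncard

/-- An infinite word is `c`-balanced when the numbers of occurrences of any letter in two of its
factors of the same length differ by at most `c`. -/
def IsBalanced (c : ℕ) (w : ℕ → A) : Prop :=
  ∀ n, ∀ u ∈ factors w n, ∀ v ∈ factors w n, ∀ a : A,
    |(u.count a : ℤ) - (v.count a : ℤ)| ≤ (c : ℤ)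

/-- The coloring of the letter `a` in `w₀` by `w₁`: the occurrences of `a` in `w₀` are replaced, in
order, by the letters of `w₁`. The two alphabets are made disjoint by the sum type, and
`Nat.count (w₀ · = a) n` is the number of occurrences of `a` strictly before position `n`. -/
def color {B : Type*} (w₀ : ℕ → A) (a : A) (w₁ : ℕ → B) : ℕ → {b : A // b ≠ a} ⊕ B :=
  fun n =>
    if h : w₀ n = a then Sum.inr (w₁ (Nat.count (fun m => w₀ m = a) n))
    else Sum.inl ⟨w₀ n, h⟩

end Complexity

section Billiard

variable {d : ℕ}

/-- The unit hypercube of dimension `d`. -/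
def unitCube (d : ℕ) : Set (Fin d → ℝ) :=
  {p | ∀ i, 0 ≤ p i ∧ p i ≤ 1}

/-- A ball of the cube at `p` with momentum `v` hits one of the two hyperfaces labeled `i`
(those orthogonal to the `i`-th axis): it lies on the hyperface, and its momentum points strictly
outwards. -/
def Hits (p v : Fin d → ℝ) (i : Fin d) : Prop :=
  (p i = 1 ∧ 0 < v i) ∨ (p i = 0 ∧ v i < 0)

/-- `w` is the sequence of labels of the hyperfaces successively hit by a billiard ball moving in
the unit hypercube with initial momentum `θ` and initial position `x`. Here `p n` and `v n` are the
position and momentum just after the first `n` hits. The ball moves in a straight line during a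
time `s n`, staying in the cube, until it hits a hyperface labeled `w n`; there the coordinate
`w n` of its momentum changes sign. Hyperfaces that are hit at the same instant (at an edge or a
corner) are listed one after the other, without time elapsing, in the order of priority `r`, which
is the same during the whole motion; `r` plays no role otherwise. -/
def IsBilliardWord (θ x : Fin d → ℝ) (w : ℕ → Fin d) : Prop :=
  ∃ (r : Equiv.Perm (Fin d)) (p v : ℕ → Fin d → ℝ) (s : ℕ → ℝ),
    p 0 = x ∧ v 0 = θ ∧
    ∀ n, 0 ≤ s n ∧
      p (n + 1) = p n + s n • v n ∧
      p (n + 1) ∈ unitCube d ∧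
      Hits (p (n + 1)) (v n) (w n) ∧
      (∀ j, Hits (p (n + 1)) (v n) j → r (w n) ≤ r j) ∧
      v (n + 1) = Function.update (v n) (w n) (-(v n (w n)))

end Billiard

end WordComb

/-!
# Binomial complexity of some words with low complexity or high balance

The two complexities of `w` agree when `2`-binomially equivalent factors `u`, `v` of the same length
are equal. The basic observation is about one letter `i`. The sum, over all prefixes of `u`, of the
numbers of letters `i` is a combination of binomial coefficients of words of length at most `2`, so
it is the same for `u` and `v`. If `w` is `1`-balanced, then the differences between the numbers of
letters `i` in the prefixes of `u` and of `v` never take both values `1` and `-1`; as their sum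
is `0`, they all vanish (`eq_zero_of_sum_eq_zero`). This settles the `1`-balanced words. It
also applies after deletion of the letters outside a set `S`, since `2`-binomial equivalence is
inherited by projections (`count_take_filter_eq_of_binom_eq`), and a word is determined by its
projections to pairs of letters (`eq_of_filter_pair_eq`). Hence it is enough that all projections of
`w` to pairs of letters be balanced (`kBinomialComplexity_eq_of_pairBalanced`).

* In a billiard word, the occurrences of a letter are scheduled along an arithmetic progression
  of times, and a projection to two letters merges two such progressions, with a fixed rule
  for ties. Such a merge is balanced (`pairBalanced_of_merge`).
* A word of complexity `n + c` has a single branching letter `s`, and a single right special factor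
  of each positive length. Depending on whether the first letter among `i`, `j` that is met after
  `s` is always the same or is decided by the branch taken (`IsBranching.firstIn_dichotomy`), the letters of the
  projection to `{i, j}` alternate, or this projection is again aperiodic with a single right
  special factor of each length. In the second case it is balanced by the theorem of Coven
  and Hedlund (`countBalanced_of_uniqueRightSpecial`). This theorem also shows that Sturmian words
  are balanced.
* In a coloring of `w₀` by `w₁`, the balance of `w₀` determines the positions and values of the
  letters of `w₀` other than `a`, and the balance of `w₁` determines the other letters.
-/

namespace WordComb

/-! ### Scattered subwords of length at most two -/

section Lists

variable {A : Type*} [DecidableEq A]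

lemma binom_nil_right (u : List A) : binom u [] = 1 := by
  induction u with
  | nil => rfl
  | cons c u ih =>
    unfold binom at *
    rw [(List.sublists_perm_sublists' _).count_eq] at *
    rw [List.sublists'_cons, List.count_append, ih, List.count_eq_zero.2 (by simp)]

lemma binom_cons_cons (c i : A) (u x : List A) :
    binom (c :: u) (i :: x) = binom u (i :: x) + if c = i then binom u x else 0 := by
  unfold binom
  simp only [(List.sublists_perm_sublists' _).count_eq]
  rw [List.sublists'_cons, List.count_append]
  congr 1
  split_ifs with h
  · subst h
    exact List.count_map_of_injective _ _ List.cons_injective _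
  · refine List.count_eq_zero.2 fun hm => ?_
    obtain ⟨y, -, hy⟩ := List.mem_map.1 hm
    exact h (List.cons.inj hy).1

lemma binom_singleton (u : List A) (i : A) : binom u [i] = u.count i := by
  induction u with
  | nil => simp [binom]
  | cons c u ih => rw [binom_cons_cons, ih, binom_nil_right, List.count_cons]; simp

lemma length_filter_mem (S : Finset A) (u : List A) :
    (u.filter (· ∈ S)).length = ∑ b ∈ S, u.count b := by
  induction u with
  | nil => simp
  | cons c u ih =>
    simp only [List.count_cons, Finset.sum_add_distrib, ← ih, List.filter_cons]
    by_cases hc : c ∈ S <;> simp [hc]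

/-- Summing the numbers of letters `i` in all prefixes counts, for each `i`, the letters from its
position on: this is a combination of binomial coefficients of words of length at most `2`. -/
lemma sum_count_take_filter (S : Finset A) {i : A} (hi : i ∈ S) (u : List A) :
    ∑ k ∈ Finset.range ((u.filter (· ∈ S)).length + 1), ((u.filter (· ∈ S)).take k).count i =
      ∑ b ∈ S, binom u [i, b] + u.count i := by
  induction u with
  | nil => simp [binom]
  | cons c u ih =>
    by_cases hc : c ∈ S
    · have hf : (c :: u).filter (· ∈ S) = c :: u.filter (· ∈ S) := by simp [hc]
      rw [hf, List.length_cons, Finset.sum_range_succ']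
      simp only [List.take_succ_cons, List.count_cons, List.take_zero, List.count_nil, add_zero,
        Finset.sum_add_distrib, ih, binom_cons_cons, binom_singleton]
      by_cases h : c = i
      · simp only [h, if_true, ← length_filter_mem]
        simp
        ring
      · simp [h]
    · have hf : (c :: u).filter (· ∈ S) = u.filter (· ∈ S) := by simp [hc]
      have hci : c ≠ i := by rintro rfl; exact hc hi
      rw [hf, ih]
      simp [binom_cons_cons, hci]

/-- An integer sequence starting from `0` whose values pairwise differ by at most `1` has a
constant sign, so it vanishes when its sum does. -/
lemma eq_zero_of_sum_eq_zero (D : ℕ → ℤ) (n : ℕ) (h0 : D 0 = 0)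
    (h : ∀ k l, k ≤ l → l ≤ n → |D l - D k| ≤ 1) (hs : ∑ k ∈ Finset.range (n + 1), D k = 0) :
    ∀ k ≤ n, D k = 0 := by
  have h' : ∀ k l, k ≤ n → l ≤ n → |D l - D k| ≤ 1 := by
    intro k l hk hl
    rcases le_total k l with hkl | hkl
    · exact h k l hkl hl
    · rw [abs_sub_comm]; exact h l k hkl hk
  by_contra! hne
  obtain ⟨k, hk, hDk⟩ := hne
  have hk0 := h 0 k (Nat.zero_le _) hk
  rw [h0, sub_zero, abs_le] at hk0
  rcases lt_or_gt_of_ne hDk with hneg | hpos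
  · have : ∑ k ∈ Finset.range (n + 1), D k < ∑ k ∈ Finset.range (n + 1), 0 := by
      refine Finset.sum_lt_sum (fun l hl => ?_) ⟨k, by simp; omega, hneg⟩
      have := h' k l hk (by simp at hl; omega)
      rw [abs_le] at this
      omega
    simp at this; omega
  · have : ∑ k ∈ Finset.range (n + 1), 0 < ∑ k ∈ Finset.range (n + 1), D k := by
      refine Finset.sum_lt_sum (fun l hl => ?_) ⟨k, by simp; omega, hpos⟩
      have := h' k l hk (by simp at hl; omega)
      rw [abs_le] at this
      omega
    simp at this; omega

lemma eq_of_count_take_eq {S : Finset A} {x y : List A} (hlen : x.length = y.length)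
    (hx : ∀ c ∈ x, c ∈ S) (h : ∀ i ∈ S, ∀ k, (x.take k).count i = (y.take k).count i) : x = y := by
  induction x generalizing y with
  | nil => exact (List.length_eq_zero_iff.1 hlen.symm).symm
  | cons c x ih =>
    cases y with
    | nil => simp at hlen
    | cons c' y =>
      have h1 := h c (hx c (by simp)) 1
      obtain rfl : c' = c := by
        by_contra hne
        simp [hne] at h1
      congr 1
      refine ih (by simpa using hlen) (fun b hb => hx b (by simp [hb])) fun i hi k => ?_
      have := h i hi (k + 1)
      simpa [List.count_cons] using this

omit [DecidableEq A] in
lemma exists_infix_filter (p : A → Bool) (u : List A) (k l : ℕ) :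
    ∃ u', u' <:+: u ∧ u'.filter p = ((u.filter p).take l).drop k := by
  have h1 : u.filter p = (u.filter p).take l ++ (u.filter p).drop l :=
    (List.take_append_drop _ _).symm
  obtain ⟨a, b, rfl, ha, -⟩ := List.filter_eq_append_iff.1 h1
  have h2 : a.filter p = (a.filter p).take k ++ (a.filter p).drop k :=
    (List.take_append_drop _ _).symm
  obtain ⟨a₁, a₂, rfl, -, ha₂⟩ := List.filter_eq_append_iff.1 h2
  refine ⟨a₂, ⟨a₁, b, rfl⟩, ?_⟩
  rw [ha₂, ha]

lemma count_filter_mem {S : Finset A} {i : A} (hi : i ∈ S) (u : List A) :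
    (u.filter (· ∈ S)).count i = u.count i :=
  List.count_filter (by simpa using hi)

lemma count_eq_of_binom_eq {u v : List A}
    (h : ∀ x : List A, x.length ≤ 2 → binom u x = binom v x) (i : A) : u.count i = v.count i := by
  rw [← binom_singleton, ← binom_singleton]
  exact h _ (by simp)

lemma length_filter_eq_of_binom_eq (S : Finset A) {u v : List A}
    (h : ∀ x : List A, x.length ≤ 2 → binom u x = binom v x) :
    (u.filter (· ∈ S)).length = (v.filter (· ∈ S)).length := by
  simp only [length_filter_mem, count_eq_of_binom_eq h]

/-- The mechanism behind all the cases: let the letters outside `S` be deleted in two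
`2`-binomially equivalent words. If the numbers of letters `i` in two factors of the same length
then differ by at most `1`, the prefixes of the same length have the same number of letters `i`.
Indeed the differences of these numbers have a constant sign and sum to `0`. -/
lemma count_take_filter_eq_of_binom_eq (S : Finset A) {u v : List A}
    (h : ∀ x : List A, x.length ≤ 2 → binom u x = binom v x) {i : A} (hi : i ∈ S)
    (hb : ∀ u' v' : List A, u' <:+: u → v' <:+: v →
      (u'.filter (· ∈ S)).length = (v'.filter (· ∈ S)).length →
        |(u'.count i : ℤ) - v'.count i| ≤ 1) (k : ℕ) :
    ((u.filter (· ∈ S)).take k).count i = ((v.filter (· ∈ S)).take k).count i := by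
  have hlen := length_filter_eq_of_binom_eq S h
  have hc := count_eq_of_binom_eq h
  have hsum := sum_count_take_filter S hi u
  have hsum' := sum_count_take_filter S hi v
  have hbin : ∑ b ∈ S, binom u [i, b] = ∑ b ∈ S, binom v [i, b] :=
    Finset.sum_congr rfl fun b _ => h _ (by simp)
  rw [hbin, hc, ← hsum'] at hsum
  rw [← hlen] at hsum
  have hsplit : ∀ (x : List A) (k l : ℕ), k ≤ l →
      (x.take l).count i = (x.take k).count i + ((x.take l).drop k).count i := by
    intro x k l hkl
    conv_lhs => rw [← List.take_append_drop k (x.take l)]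
    rw [List.count_append, List.take_take, min_eq_left hkl]
  have key := eq_zero_of_sum_eq_zero
    (fun k => (((u.filter (· ∈ S)).take k).count i : ℤ) - ((v.filter (· ∈ S)).take k).count i)
    (u.filter (· ∈ S)).length (by simp) ?_ ?_
  · rcases le_total k (u.filter (· ∈ S)).length with hk | hk
    · have := key k hk
      simp only at this
      omega
    · rw [List.take_of_length_le hk, List.take_of_length_le (hlen ▸ hk), count_filter_mem hi,
        count_filter_mem hi, hc]
  · intro k l hkl hl
    obtain ⟨u', hu', hfu⟩ := exists_infix_filter (· ∈ S) u k l
    obtain ⟨v', hv', hfv⟩ := exists_infix_filter (· ∈ S) v k l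
    have := hb u' v' hu' hv' (by rw [hfu, hfv]; simp [hlen])
    rw [← count_filter_mem hi u', ← count_filter_mem hi v', hfu, hfv] at this
    rw [hsplit _ k l hkl, hsplit (v.filter _) k l hkl]
    push_cast
    convert this using 2
    ring
  · rw [Finset.sum_sub_distrib, sub_eq_zero]
    exact_mod_cast hsum

lemma filter_eq_of_binom_eq (S : Finset A) {u v : List A}
    (h : ∀ x : List A, x.length ≤ 2 → binom u x = binom v x)
    (hb : ∀ i ∈ S, ∀ u' v' : List A, u' <:+: u → v' <:+: v →
      (u'.filter (· ∈ S)).length = (v'.filter (· ∈ S)).length →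
        |(u'.count i : ℤ) - v'.count i| ≤ 1) :
    u.filter (· ∈ S) = v.filter (· ∈ S) :=
  eq_of_count_take_eq (length_filter_eq_of_binom_eq S h)
    (fun c hc => by simpa using (List.mem_filter.1 hc).2)
    fun i hi k => count_take_filter_eq_of_binom_eq S h hi (hb i hi) k

/-- A word is determined by its length and its projections to pairs of letters. -/
lemma eq_of_filter_pair_eq {u v : List A} (hlen : u.length = v.length)
    (h : ∀ i j : A, i ≠ j →
      u.filter (· ∈ ({i, j} : Finset A)) = v.filter (· ∈ ({i, j} : Finset A))) : u = v := by
  induction u generalizing v with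
  | nil => exact (List.length_eq_zero_iff.1 hlen.symm).symm
  | cons a u ih =>
    cases v with
    | nil => simp at hlen
    | cons b v =>
      obtain rfl : a = b := by
        by_contra hab
        have := h a b hab
        simp [hab] at this
      congr 1
      refine ih (by simpa using hlen) fun i j hij => ?_
      have := h i j hij
      by_cases ha : a ∈ ({i, j} : Finset A)
      · rw [List.filter_cons_of_pos (by simpa using ha),
          List.filter_cons_of_pos (by simpa using ha)] at this
        exact (List.cons.inj this).2
      · rwa [List.filter_cons_of_neg (by simpa using ha),
          List.filter_cons_of_neg (by simpa using ha)] at this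

end Lists

/-! ### Factors of infinite words -/

section Factors

variable {A : Type*}

lemma length_factorAt (w : ℕ → A) (p n : ℕ) : (factorAt w p n).length = n := by simp [factorAt]

lemma getElem_factorAt (w : ℕ → A) (p n k : ℕ) (h : k < (factorAt w p n).length) :
    (factorAt w p n)[k] = w (p + k) := by simp [factorAt]

lemma factorAt_eq_iff (w : ℕ → A) (p q n : ℕ) :
    factorAt w p n = factorAt w q n ↔ ∀ k < n, w (p + k) = w (q + k) := by
  rw [factorAt, factorAt, List.ofFn_inj, funext_iff, Fin.forall_iff]

lemma factorAt_succ (w : ℕ → A) (p n : ℕ) :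
    factorAt w p (n + 1) = factorAt w p n ++ [w (p + n)] := by
  rw [factorAt, List.ofFn_succ_last]
  rfl

lemma exists_of_infix_factorAt {w : ℕ → A} {p n : ℕ} {u : List A} (h : u <:+: factorAt w p n) :
    ∃ q, u = factorAt w q u.length := by
  obtain ⟨s, t, hst⟩ := h
  refine ⟨p + s.length, List.ext_getElem (by simp [length_factorAt]) fun k h1 h2 => ?_⟩
  rw [getElem_factorAt, add_assoc, ← getElem_factorAt w p n (s.length + k) (by
    rw [← hst]; simp; omega)]
  simp only [← hst]
  rw [List.getElem_append_left (by simp; omega), List.getElem_append_right (by simp)]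
  simp

variable [DecidableEq A]

lemma count_factorAt (w : ℕ → A) (i : A) (p n : ℕ) :
    Nat.count (w · = i) (p + n) = Nat.count (w · = i) p + (factorAt w p n).count i := by
  induction n with
  | zero => simp [factorAt]
  | succ n ih =>
    rw [← add_assoc, Nat.count_succ, ih, factorAt_succ, List.count_append, add_assoc]
    simp [List.count_singleton]

/-- The complexities agree as soon as `2`-binomially equivalent factors are equal. -/
lemma kBinomialComplexity_eq (w : ℕ → A)
    (h : ∀ p q n, (∀ x : List A, x.length ≤ 2 →
      binom (factorAt w p n) x = binom (factorAt w q n) x) → factorAt w p n = factorAt w q n) :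
    kBinomialComplexity 2 w = subwordComplexity w := by
  funext n
  refine Set.InjOn.ncard_image ?_
  rintro _ ⟨p, rfl⟩ _ ⟨q, rfl⟩ hpq
  exact h p q n (Quotient.exact hpq)

/-- Two letters `i` and `j` are balanced in `w` when no two factors of `w` are such that one has
at least two letters `i` more, and the other at least two letters `j` more. Factors are given by
their end positions. For an infinite word over `{i, j}` this is `1`-balance; in general it
says that the word left after deleting the other letters, be it finite or infinite, is
`1`-balanced. -/
def PairBalanced (w : ℕ → A) (i j : A) : Prop :=
  ∀ p p' q q', p ≤ p' → q ≤ q' →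
    Nat.count (w · = i) q' + Nat.count (w · = i) p + 2 ≤
      Nat.count (w · = i) p' + Nat.count (w · = i) q →
    Nat.count (w · = j) p' + Nat.count (w · = j) q + 2 ≤
      Nat.count (w · = j) q' + Nat.count (w · = j) p → False

theorem kBinomialComplexity_eq_of_pairBalanced {w : ℕ → A}
    (h : ∀ i j, i ≠ j → PairBalanced w i j) :
    kBinomialComplexity 2 w = subwordComplexity w := by
  refine kBinomialComplexity_eq w fun p q n hbin =>
    eq_of_filter_pair_eq (by simp [length_factorAt]) fun i j hij =>
      filter_eq_of_binom_eq _ hbin ?_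
  have main : ∀ i j, i ≠ j → ∀ u' v' : List A, u' <:+: factorAt w p n → v' <:+: factorAt w q n →
      u'.count i + u'.count j = v'.count i + v'.count j →
        |(u'.count i : ℤ) - v'.count i| ≤ 1 := by
    intro i j hij u' v' hu hv hlen
    obtain ⟨p', hp'⟩ := exists_of_infix_factorAt hu
    obtain ⟨q', hq'⟩ := exists_of_infix_factorAt hv
    have h1 := count_factorAt w i p' u'.length
    have h2 := count_factorAt w i q' v'.length
    have h3 := count_factorAt w j p' u'.length
    have h4 := count_factorAt w j q' v'.length
    rw [← hp'] at h1 h3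
    rw [← hq'] at h2 h4
    have e1 := h i j hij p' _ q' _ (Nat.le_add_right p' u'.length) (Nat.le_add_right q' v'.length)
    have e2 := h i j hij q' _ p' _ (Nat.le_add_right q' v'.length) (Nat.le_add_right p' u'.length)
    rw [abs_le]
    by_contra hcon
    by_cases hlt : (u'.count i : ℤ) - v'.count i ≤ 1
    · exact e2 (by omega) (by omega)
    · exact e1 (by omega) (by omega)
  intro k hk u' v' hu hv hlen
  simp only [length_filter_mem, Finset.sum_pair hij] at hlen
  rcases Finset.mem_insert.1 hk with rfl | hk
  · exact main k j hij u' v' hu hv hlen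
  · rw [Finset.mem_singleton] at hk
    subst hk
    exact main k i hij.symm u' v' hu hv (by omega)

/-- The case of `1`-balanced words. -/
theorem kBinomialComplexity_eq_of_isBalanced [Fintype A] {w : ℕ → A} (h : IsBalanced 1 w) :
    kBinomialComplexity 2 w = subwordComplexity w := by
  refine kBinomialComplexity_eq w fun p q n hbin => ?_
  have := filter_eq_of_binom_eq Finset.univ hbin fun i _ u' v' hu hv hlen => by
    obtain ⟨p', hp'⟩ := exists_of_infix_factorAt hu
    obtain ⟨q', hq'⟩ := exists_of_infix_factorAt hv
    simp only [Finset.mem_univ, decide_true, List.filter_true] at hlen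
    have := h u'.length u' ⟨p', hp'⟩ v' ⟨q', by rw [hlen]; exact hq'⟩ i
    simpa using this
  simpa using this

end Factors

/-! ### Right special factors -/

section RightSpecial

variable {A : Type*}

/-- The factors of length `n` of `w` at the positions `p` and `q` are equal. -/
def Agree (w : ℕ → A) (p q n : ℕ) : Prop :=
  ∀ k < n, w (p + k) = w (q + k)

/-- Any two right special factors of length `n` of `w` are equal. A right special factor, one that
can be continued by several letters, is given by two of its occurrences `p` and `q` that are
followed by different letters. -/
def UniqueRightSpecial (w : ℕ → A) (n : ℕ) : Prop :=
  ∀ p q p' q', Agree w p q n → w (p + n) ≠ w (q + n) →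
    Agree w p' q' n → w (p' + n) ≠ w (q' + n) → Agree w p p' n

/-- `w` is eventually periodic. -/
def EventuallyPeriodic (w : ℕ → A) : Prop :=
  ∃ N d, 0 < d ∧ ∀ k ≥ N, w (k + d) = w k

lemma Agree.symm {w : ℕ → A} {p q n : ℕ} (h : Agree w p q n) : Agree w q p n :=
  fun k hk => (h k hk).symm

lemma Agree.trans {w : ℕ → A} {p q r n : ℕ} (h : Agree w p q n) (h' : Agree w q r n) :
    Agree w p r n :=
  fun k hk => (h k hk).trans (h' k hk)

lemma Agree.mono {w : ℕ → A} {p q m n : ℕ} (h : Agree w p q n) (hmn : m ≤ n) : Agree w p q m :=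
  fun k hk => h k (hk.trans_le hmn)

lemma Agree.drop {w : ℕ → A} {p q n : ℕ} (m : ℕ) (h : Agree w p q (m + n)) :
    Agree w (p + m) (q + m) n :=
  fun k hk => by rw [add_assoc, add_assoc]; exact h _ (by omega)

lemma Agree.succ {w : ℕ → A} {p q n : ℕ} (h : Agree w p q n) (h' : w (p + n) = w (q + n)) :
    Agree w p q (n + 1) := fun k hk => by
  rcases Nat.lt_succ_iff_lt_or_eq.1 hk with hk | rfl
  exacts [h k hk, h']

lemma factorAt_eq_iff_agree (w : ℕ → A) (p q n : ℕ) :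
    factorAt w p n = factorAt w q n ↔ Agree w p q n :=
  factorAt_eq_iff w p q n

lemma exists_agree [Finite A] (w : ℕ → A) (N n : ℕ) :
    ∃ p q, N ≤ p ∧ p < q ∧ Agree w p q n := by
  obtain ⟨a, b, hab, h⟩ := Finite.exists_ne_map_eq_of_infinite
    fun p : ℕ => fun k : Fin n => w (N + p + k)
  have hag : Agree w (N + a) (N + b) n := fun k hk => congrFun h ⟨k, hk⟩
  rcases lt_or_gt_of_ne hab with hlt | hlt
  · exact ⟨N + a, N + b, by omega, by omega, hag⟩
  · exact ⟨N + b, N + a, by omega, by omega, hag.symm⟩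

/-- If from position `p` on, every factor of length `n` determines the next letter, then a
repetition of such a factor makes the word periodic. -/
lemma eventuallyPeriodic_of_agree {w : ℕ → A} {p q n : ℕ} (hpq : p < q) (h : Agree w p q n)
    (hdet : ∀ r r', p ≤ r → p ≤ r' → Agree w r r' n → w (r + n) = w (r' + n)) :
    EventuallyPeriodic w := by
  have key : ∀ k, Agree w (p + k) (q + k) n := by
    intro k
    induction k with
    | zero => exact h
    | succ k ih =>
      have := ih.succ (hdet _ _ (by omega) (by omega) ih)
      rw [add_comm n 1] at this
      exact this.drop 1
  refine ⟨p + n, q - p, by omega, fun k hk => ?_⟩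
  have := hdet (p + (k - p - n)) (q + (k - p - n)) (by omega) (by omega) (key _)
  rw [show p + (k - p - n) + n = k by omega,
    show q + (k - p - n) + n = k + (q - p) by omega] at this
  exact this.symm

lemma exists_rightSpecial [Finite A] {w : ℕ → A} (hw : ¬ EventuallyPeriodic w) (N n : ℕ) :
    ∃ p q, N ≤ p ∧ N ≤ q ∧ Agree w p q n ∧ w (p + n) ≠ w (q + n) := by
  by_contra! hcon
  obtain ⟨p, q, hp, hpq, h⟩ := exists_agree w N n
  exact hw (eventuallyPeriodic_of_agree hpq h fun r r' hr hr' =>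
    hcon r r' (hp.trans hr) (hp.trans hr'))

lemma finite_factors [Finite A] (w : ℕ → A) (n : ℕ) : (factors w n).Finite := by
  refine (Set.finite_range fun f : Fin n → A => List.ofFn f).subset ?_
  rintro _ ⟨p, rfl⟩
  exact ⟨_, rfl⟩

lemma factors_eq_image (w : ℕ → A) (n : ℕ) :
    factors w n = List.dropLast '' factors w (n + 1) := by
  ext u
  constructor
  · rintro ⟨p, rfl⟩
    exact ⟨_, ⟨p, rfl⟩, by rw [factorAt_succ, List.dropLast_concat]⟩
  · rintro ⟨_, ⟨p, rfl⟩, rfl⟩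
    exact ⟨p, by rw [factorAt_succ, List.dropLast_concat]⟩

/-- A map onto a set with at most one element less has at most one fiber that is not a singleton,
and it has two elements. -/
lemma eq_of_ncard_le_ncard_image_add_one {α β : Type*} {F : Set α} (hF : F.Finite) (f : α → β)
    (hcard : F.ncard ≤ (f '' F).ncard + 1) {x y x' y' : α} (hx : x ∈ F) (hy : y ∈ F)
    (hx' : x' ∈ F) (hxy : x ≠ y) (hf : f x = f y) (hxy' : x' ≠ y') (hf' : f x' = f y')
    (hy' : y' ∈ F) : f x = f x' ∧ (x' = x ∨ x' = y) := by
  -- Two elements whose removal does not change the image cannot both exist.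
  have key : ∀ a b c d, a ∈ F → b ∈ F → a ≠ b → c ∈ F → d ∈ F → c ≠ a → c ≠ b → d ≠ a → d ≠ b →
      f c = f a → f d = f b → False := by
    intro a b c d ha hb hab hc hd hca hcb hda hdb hfc hfd
    have himg : f '' F ⊆ f '' (F \ {a, b}) := by
      rintro _ ⟨z, hz, rfl⟩
      by_cases hza : z = a
      · exact ⟨c, ⟨hc, by simp [hca, hcb]⟩, by rw [hfc, hza]⟩
      by_cases hzb : z = b
      · exact ⟨d, ⟨hd, by simp [hda, hdb]⟩, by rw [hfd, hzb]⟩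
      exact ⟨z, ⟨hz, by simp [hza, hzb]⟩, rfl⟩
    have h1 := Set.ncard_le_ncard himg ((hF.subset Set.sdiff_subset).image f)
    have h2 := Set.ncard_image_le (f := f) (hF.subset (Set.sdiff_subset (t := {a, b})))
    have h3 : ({a, b} : Set α).ncard = 2 := Set.ncard_pair hab
    have h4 := Set.ncard_sdiff_add_ncard_of_subset (s := {a, b}) (t := F)
      (by rintro z (rfl | rfl) <;> assumption) hF
    omega
  have hfx : f x = f x' := by
    by_contra hne
    have e1 : x ≠ x' := fun e => hne (by rw [e])
    have e2 : x ≠ y' := fun e => hne (by rw [e, hf'])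
    have e3 : y ≠ x' := fun e => hne (by rw [← e, hf])
    have e4 : y ≠ y' := fun e => hne (by rw [hf', ← e, hf])
    exact key y y' x x' hy hy' e4 hx hx' hxy e2 e3.symm hxy' hf hf'
  refine ⟨hfx, ?_⟩
  by_contra! hne
  exact key y x' x x hy hx' hne.2.symm hx hx hxy hne.1.symm hxy hne.1.symm hf hfx

lemma rightSpecial_unique_of_subwordComplexity [Finite A] {w : ℕ → A} {n : ℕ}
    (hn : subwordComplexity w (n + 1) ≤ subwordComplexity w n + 1) {p q p' q' : ℕ}
    (h : Agree w p q n) (hne : w (p + n) ≠ w (q + n))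
    (h' : Agree w p' q' n) (hne' : w (p' + n) ≠ w (q' + n)) :
    Agree w p p' n ∧ (w (p' + n) = w (p + n) ∨ w (p' + n) = w (q + n)) := by
  unfold subwordComplexity at hn
  rw [factors_eq_image w n] at hn
  have hdrop : ∀ r, (factorAt w r (n + 1)).dropLast = factorAt w r n := fun r => by
    rw [factorAt_succ, List.dropLast_concat]
  have hlast : ∀ {r r'}, factorAt w r (n + 1) = factorAt w r' (n + 1) → w (r + n) = w (r' + n) :=
    fun h => (factorAt_eq_iff w _ _ _).1 h n (Nat.lt_succ_self n)
  have key := eq_of_ncard_le_ncard_image_add_one (finite_factors w (n + 1)) List.dropLast hn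
    (x := factorAt w p (n + 1)) (y := factorAt w q (n + 1))
    (x' := factorAt w p' (n + 1)) (y' := factorAt w q' (n + 1))
    ⟨p, rfl⟩ ⟨q, rfl⟩ ⟨p', rfl⟩ (fun e => hne (hlast e))
    (by rw [hdrop, hdrop, factorAt_eq_iff_agree]; exact h) (fun e => hne' (hlast e))
    (by rw [hdrop, hdrop, factorAt_eq_iff_agree]; exact h') ⟨q', rfl⟩
  rw [hdrop, hdrop, factorAt_eq_iff_agree] at key
  exact ⟨key.1, key.2.imp hlast hlast⟩

lemma uniqueRightSpecial_of_subwordComplexity [Finite A] {w : ℕ → A} {n : ℕ}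
    (hn : subwordComplexity w (n + 1) ≤ subwordComplexity w n + 1) : UniqueRightSpecial w n :=
  fun _ _ _ _ h hne h' hne' => (rightSpecial_unique_of_subwordComplexity hn h hne h' hne').1

/-- An eventually periodic word has a bounded complexity. -/
lemma not_eventuallyPeriodic_of_lt [Finite A] {w : ℕ → A}
    (h : ∀ n, 0 < n → n < subwordComplexity w n) : ¬ EventuallyPeriodic w := by
  rintro ⟨N, d, hd, hper⟩
  have hsub : factors w (N + d) ⊆ (fun p => factorAt w p (N + d)) '' Set.Iio (N + d) := by
    have : ∀ p, ∃ q < N + d, factorAt w p (N + d) = factorAt w q (N + d) := by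
      intro p
      induction p using Nat.strong_induction_on with
      | _ p ih =>
        by_cases hp : p < N + d
        · exact ⟨p, hp, rfl⟩
        · obtain ⟨q, hq, hpq⟩ := ih (p - d) (by omega)
          refine ⟨q, hq, Eq.trans ?_ hpq⟩
          rw [factorAt_eq_iff]
          intro k _
          rw [← hper (p - d + k) (by omega)]
          congr 1
          omega
    rintro _ ⟨p, rfl⟩
    obtain ⟨q, hq, hpq⟩ := this p
    exact ⟨q, hq, hpq.symm⟩
  have h1 := Set.ncard_le_ncard hsub ((Set.finite_Iio _).image _)
  have h2 := Set.ncard_image_le (f := fun p => factorAt w p (N + d)) (Set.finite_Iio (N + d))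
  have h3 : (Set.Iio (N + d)).ncard = N + d := by
    rw [Set.ncard_eq_toFinset_card']; simp
  have := h (N + d) (by omega)
  unfold subwordComplexity at this
  omega

end RightSpecial

/-! ### Balance of binary words -/

section Binary

variable {A : Type*} [DecidableEq A] {z : ℕ → A} {i j : A}

/-- A binary word has at most one factor more of length `n + 1` than of length `n` when it has at
most one right special factor of length `n`. -/
lemma subwordComplexity_le_of_uniqueRightSpecial (hz : ∀ k, z k = i ∨ z k = j)
    (hRS : ∀ n, UniqueRightSpecial z n) (n : ℕ) :
    (factors z n).Finite ∧ (factors z n).ncard ≤ n + 1 := by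
  induction n with
  | zero =>
    have : factors z 0 = {[]} := by
      ext u
      simp [factors, factorAt]
    rw [this]
    simp
  | succ n ih =>
    -- Removing one continuation of the right special factor makes `dropLast` injective.
    have hinj : ∃ v, Set.InjOn List.dropLast (factors z (n + 1) \ {v}) := by
      by_cases hex : ∃ p q, Agree z p q n ∧ z (p + n) ≠ z (q + n)
      · obtain ⟨p, q, hpq, hne⟩ := hex
        refine ⟨factorAt z q (n + 1), ?_⟩
        rintro _ ⟨⟨r, rfl⟩, hr⟩ _ ⟨⟨r', rfl⟩, hr'⟩ he
        rw [factorAt_succ, factorAt_succ, List.dropLast_concat, List.dropLast_concat,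
          factorAt_eq_iff_agree] at he
        rw [Set.mem_singleton_iff, factorAt_eq_iff_agree] at hr hr'
        rw [factorAt_eq_iff_agree]
        refine he.succ (by_contra fun hne' => ?_)
        have hrq := (hRS n p q r r' hpq hne he hne').symm.trans hpq
        have h1 : z (r + n) ≠ z (q + n) := fun e => hr (hrq.succ e)
        have h2 : z (r' + n) ≠ z (q + n) := fun e => hr' ((he.symm.trans hrq).succ e)
        rcases hz (r + n) with e1 | e1 <;> rcases hz (r' + n) with e2 | e2 <;>
          rcases hz (q + n) with e3 | e3 <;> simp_all
      · push Not at hex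
        refine ⟨[], ?_⟩
        rintro _ ⟨⟨r, rfl⟩, -⟩ _ ⟨⟨r', rfl⟩, -⟩ he
        rw [factorAt_succ, factorAt_succ, List.dropLast_concat, List.dropLast_concat,
          factorAt_eq_iff_agree] at he
        rw [factorAt_eq_iff_agree]
        exact he.succ (hex r r' he)
    obtain ⟨v, hv⟩ := hinj
    have hmaps : List.dropLast '' (factors z (n + 1) \ {v}) ⊆ factors z n := by
      rw [factors_eq_image z n]
      exact Set.image_mono Set.sdiff_subset
    have hfin : (factors z (n + 1) \ {v}).Finite :=
      Set.Finite.of_finite_image (ih.1.subset hmaps) hv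
    have hfin' : (factors z (n + 1)).Finite :=
      (hfin.insert v).subset fun u hu => by
        by_cases huv : u = v
        · exact Or.inl huv
        · exact Or.inr ⟨hu, huv⟩
    refine ⟨hfin', ?_⟩
    have h1 := Set.ncard_le_ncard hmaps ih.1
    rw [hv.ncard_image] at h1
    have h2 := Set.pred_ncard_le_ncard_sdiff_singleton (factors z (n + 1)) v
    omega

/-- The numbers of letters `i` in two factors of the same length of `z` differ by at most `1`. -/
def CountBalanced (z : ℕ → A) (i : A) : Prop :=
  ∀ p q n, Nat.count (z · = i) (p + n) + Nat.count (z · = i) q ≤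
    Nat.count (z · = i) (q + n) + Nat.count (z · = i) p + 1

/-- A word that is not balanced has factors `iui` and `juj` where `u` is a palindrome and `j ≠ i`:
take two factors of minimal length whose numbers of letters `i` differ by at least `2`. -/
lemma exists_palindrome_of_not_countBalanced (hz : ∀ k, z k = i ∨ z k = j) (hij : i ≠ j)
    (h : ¬ CountBalanced z i) :
    ∃ p q m, z p = i ∧ z (p + m + 1) = i ∧ z q = j ∧ z (q + m + 1) = j ∧
      Agree z (p + 1) (q + 1) m ∧ ∀ k < m, z (p + 1 + k) = z (p + m - k) := by
  set c := Nat.count (z · = i) with hc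
  have hex : ∃ n p q, c (q + n) + c p + 2 ≤ c (p + n) + c q := by
    unfold CountBalanced at h
    push Not at h
    obtain ⟨p, q, n, h⟩ := h
    exact ⟨n, p, q, by simp only [hc]; omega⟩
  classical
  obtain ⟨p, q, hpq⟩ := Nat.find_spec hex
  have hmin : ∀ m < Nat.find hex, ∀ p q, c (p + m) + c q ≤ c (q + m) + c p + 1 := by
    intro m hm p q
    have := Nat.find_min hex hm
    push Not at this
    have := this p q
    omega
  set n := Nat.find hex
  have hstep : ∀ k, c (k + 1) = c k + if z k = i then 1 else 0 := fun k => Nat.count_succ _ _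
  have hle : ∀ k, c k ≤ c (k + 1) ∧ c (k + 1) ≤ c k + 1 := fun k => by
    rw [hstep]; split_ifs <;> omega
  have hi : ∀ k, c (k + 1) = c k + 1 → z k = i := fun k hk => by
    by_contra hne; rw [hstep, if_neg hne] at hk; omega
  have hj : ∀ k, c (k + 1) = c k → z k = j := fun k hk => by
    rcases hz k with e | e
    · rw [hstep, if_pos e] at hk; omega
    · exact e
  have hn0 : n ≠ 0 := fun e => by rw [e] at hpq; simp at hpq; omega
  have hn1 : n ≠ 1 := fun e => by
    rw [e] at hpq; have := hle p; have := hle q; omega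
  -- The difference of the two prefixes of length `k` is `1` for `0 < k < n`.
  have hpre : ∀ k, 0 < k → k < n → c (p + k) + c q = c (q + k) + c p + 1 := by
    intro k hk hkn
    have h1 := hmin k hkn p q
    have h2 := hmin (n - k) (by omega) (p + k) (q + k)
    rw [show p + k + (n - k) = p + n by omega, show q + k + (n - k) = q + n by omega] at h2
    omega
  have htot : c (p + n) + c q = c (q + n) + c p + 2 := by
    have h1 := hpre (n - 1) (by omega) (by omega)
    have h2 := hle (p + (n - 1))
    have h3 := hle (q + (n - 1))
    rw [show p + (n - 1) + 1 = p + n by omega] at h2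
    rw [show q + (n - 1) + 1 = q + n by omega] at h3
    omega
  -- Comparing prefixes with suffixes gives the palindrome.
  have hpal : ∀ k, 0 < k → k < n → c (p + k) + c (p + (n - k)) = c (p + n) + c p := by
    intro k hk hkn
    have h1 := hmin k hkn p (q + (n - k))
    have h2 := hmin k hkn (p + (n - k)) q
    rw [show q + (n - k) + k = q + n by omega] at h1
    rw [show p + (n - k) + k = p + n by omega] at h2
    have h3 := hpre k hk hkn
    have h4 := hpre (n - k) (by omega) (by omega)
    omega
  have e1 := hpre 1 (by omega) (by omega)
  have e2 := hpre (n - 1) (by omega) (by omega)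
  have l1 := hle p
  have l2 := hle q
  have l3 := hle (p + (n - 1))
  have l4 := hle (q + (n - 1))
  rw [show p + (n - 1) + 1 = p + n by omega] at l3
  rw [show q + (n - 1) + 1 = q + n by omega] at l4
  refine ⟨p, q, n - 2, hi _ (by omega), hi _ ?_, hj _ (by omega), hj _ ?_, fun k hk => ?_,
    fun k hk => ?_⟩
  · rw [show p + (n - 2) + 1 + 1 = p + n by omega, show p + (n - 2) + 1 = p + (n - 1) by omega]
    omega
  · rw [show q + (n - 2) + 1 + 1 = q + n by omega, show q + (n - 2) + 1 = q + (n - 1) by omega]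
    omega
  · have h1 := hpre (1 + k) (by omega) (by omega)
    have h2 := hpre (1 + k + 1) (by omega) (by omega)
    simp only [← add_assoc] at h1 h2
    rcases hz (p + 1 + k) with e | e
    · rw [e, eq_comm]
      have := hstep (p + 1 + k)
      rw [if_pos e] at this
      exact hi _ (by omega)
    · rw [e, eq_comm]
      have := hstep (p + 1 + k)
      rw [if_neg (by rw [e]; exact hij.symm)] at this
      exact hj _ (by omega)
  · have h1 := hpal (1 + k) (by omega) (by omega)
    have h2 := hpal (1 + k + 1) (by omega) (by omega)
    rw [show p + (n - (1 + k)) = p + (n - 2) - k + 1 by omega] at h1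
    rw [show p + (n - (1 + k + 1)) = p + (n - 2) - k by omega] at h2
    simp only [← add_assoc] at h1 h2
    rcases hz (p + 1 + k) with e | e
    · rw [e, eq_comm]
      have := hstep (p + 1 + k)
      rw [if_pos e] at this
      exact hi _ (by omega)
    · rw [e, eq_comm]
      have := hstep (p + 1 + k)
      rw [if_neg (by rw [e]; exact hij.symm)] at this
      exact hj _ (by omega)

/-- The theorem of Coven and Hedlund: an aperiodic binary word with at most one right special
factor of each length is balanced. Otherwise there are factors `iui` and `juj` with `u` a
palindrome, and one of `iu`, `ju` is the right special factor, say `xu`. If `y` is the other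
letter, then `xu` occurs neither at the start of an occurrence of `yuy` nor at the following
`|u| + 1` positions. The factors of length `|u| + 1` at these `|u| + 2` positions thus take at most
`|u| + 1` values, and a repetition makes the word periodic. -/
theorem countBalanced_of_uniqueRightSpecial (hz : ∀ k, z k = i ∨ z k = j) (hij : i ≠ j)
    (hRS : ∀ n, UniqueRightSpecial z n) (hper : ¬ EventuallyPeriodic z) :
    CountBalanced z i := by
  by_contra hbal
  obtain ⟨p, q, m, hp, hp', hq, hq', hag, hpal⟩ :=
    exists_palindrome_of_not_countBalanced hz hij hbal
  -- `p₀` is an occurrence of the right special factor of length `m + 1`.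
  obtain ⟨p₀, q₀, hag₀, hne₀⟩ : ∃ p₀ q₀, Agree z p₀ q₀ (m + 1) ∧
      z (p₀ + (m + 1)) ≠ z (q₀ + (m + 1)) := by
    by_contra! hcon
    have hfin := (subwordComplexity_le_of_uniqueRightSpecial hz hRS (m + 1)).1
    obtain ⟨a, -, b, -, hab, he⟩ := Set.infinite_univ.exists_ne_map_eq_of_mapsTo
      (f := fun r => factorAt z r (m + 1)) (t := factors z (m + 1)) (fun r _ => ⟨r, rfl⟩) hfin
    rw [factorAt_eq_iff_agree] at he
    rcases lt_or_gt_of_ne hab with hlt | hlt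
    · exact hper (eventuallyPeriodic_of_agree hlt he fun r r' _ _ => hcon r r')
    · exact hper (eventuallyPeriodic_of_agree hlt he.symm fun r r' _ _ => hcon r r')
  have hp₀ : Agree z (p₀ + 1) (p + 1) m := by
    refine hRS m (p₀ + 1) (q₀ + 1) (p + 1) (q + 1) ?_ ?_ hag ?_
    · exact Agree.drop 1 (by rwa [add_comm 1 m])
    · rwa [add_assoc, add_assoc, add_comm 1 m]
    · rw [show p + 1 + m = p + m + 1 by omega, show q + 1 + m = q + m + 1 by omega, hp', hq']
      exact hij
  -- `P` is an occurrence of `yuy`.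
  obtain ⟨P, y, hPy, hP, hP', hPu, hPpal⟩ : ∃ P y, z p₀ ≠ y ∧ z P = y ∧ z (P + m + 1) = y ∧
      Agree z (p₀ + 1) (P + 1) m ∧ ∀ k < m, z (P + 1 + k) = z (P + m - k) := by
    rcases hz p₀ with e | e
    · refine ⟨q, j, by rw [e]; exact hij, hq, hq', hp₀.trans hag, fun k hk => ?_⟩
      rw [← hag k hk, hpal k hk, show p + m - k = p + 1 + (m - 1 - k) by omega,
        hag _ (by omega), show q + m - k = q + 1 + (m - 1 - k) by omega]
    · exact ⟨p, i, by rw [e]; exact hij.symm, hp, hp', hp₀, hpal⟩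
  have hwin : ∀ t, t ≤ m + 1 → ¬ Agree z (P + t) p₀ (m + 1) := by
    intro t ht hcon
    have h0 : z (P + t) = z p₀ := hcon 0 (by omega)
    rcases Nat.eq_zero_or_pos t with rfl | htpos
    · exact hPy (by rw [← h0, ← hP]; rfl)
    rcases Nat.lt_or_ge m t with hmt | hmt
    · obtain rfl : t = m + 1 := by omega
      exact hPy (by rw [← h0, ← hP']; rfl)
    · -- The letter `x` at `P + t` has the letter `y` at `P + m + 1` as its mirror image in `xu`.
      have h1 := hcon (m + 1 - t) (by omega)
      rw [show P + t + (m + 1 - t) = P + m + 1 by omega, hP',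
        show p₀ + (m + 1 - t) = p₀ + 1 + (m - t) by omega, hPu _ (by omega),
        hPpal _ (by omega), show P + m - (m - t) = P + t by omega, h0] at h1
      exact hPy h1.symm
  -- Two of the factors of length `m + 1` at `P`, …, `P + m + 1` are equal.
  obtain ⟨s, t, hst, ht, hrep⟩ : ∃ s t, s < t ∧ t ≤ m + 1 ∧ Agree z (P + s) (P + t) (m + 1) := by
    obtain ⟨hfin, hcard⟩ := subwordComplexity_le_of_uniqueRightSpecial hz hRS (m + 1)
    have hcard' : (factors z (m + 1) \ {factorAt z p₀ (m + 1)}).ncard <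
        (Set.Iio (m + 2)).ncard := by
      have hmem : factorAt z p₀ (m + 1) ∈ factors z (m + 1) := ⟨p₀, rfl⟩
      rw [Set.ncard_sdiff_singleton_of_mem hmem]
      have : (Set.Iio (m + 2)).ncard = m + 2 := by rw [Set.ncard_eq_toFinset_card']; simp
      omega
    obtain ⟨s, hs, t, ht, hst, he⟩ := Set.exists_ne_map_eq_of_ncard_lt_of_maps_to hcard'
      (f := fun t => factorAt z (P + t) (m + 1)) (fun t ht => ⟨⟨P + t, rfl⟩, fun he =>
        hwin t (by simp at ht; omega) ((factorAt_eq_iff_agree _ _ _ _).1 he)⟩)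
      (hfin.subset Set.sdiff_subset)
    rw [factorAt_eq_iff_agree] at he
    simp only [Set.mem_Iio] at hs ht
    rcases lt_or_gt_of_ne hst with hlt | hlt
    · exact ⟨s, t, hlt, by omega, he⟩
    · exact ⟨t, s, hlt, by omega, he.symm⟩
  -- From there on, the right special factor never occurs, and the word is periodic.
  have key : ∀ k, Agree z (P + s + k) (P + t + k) (m + 1) ∧
      ¬ Agree z (P + s + k) p₀ (m + 1) := by
    intro k
    induction k using Nat.strong_induction_on with
    | _ k ih =>
      constructor
      · rcases Nat.eq_zero_or_pos k with rfl | hk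
        · exact hrep
        · obtain ⟨h1, h2⟩ := ih (k - 1) (by omega)
          have h3 : z (P + s + (k - 1) + (m + 1)) = z (P + t + (k - 1) + (m + 1)) := by
            by_contra hne
            exact h2 (hRS _ _ _ _ _ h1 hne hag₀ hne₀)
          have h4 := h1.succ h3
          rw [add_comm (m + 1) 1] at h4
          have h5 := h4.drop 1
          rwa [show P + s + (k - 1) + 1 = P + s + k by omega,
            show P + t + (k - 1) + 1 = P + t + k by omega] at h5
      · by_cases hk : k < t - s
        · rw [add_assoc]
          exact hwin _ (by omega)
        · obtain ⟨h1, h2⟩ := ih (k - (t - s)) (by omega)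
          rw [show P + t + (k - (t - s)) = P + s + k by omega] at h1
          exact fun hcon => h2 (h1.trans hcon)
  exact hper ⟨P + s, t - s, by omega, fun k hk => by
    have := (key (k - P - s)).1 0 (by omega)
    rw [show P + s + (k - P - s) + 0 = k by omega,
      show P + t + (k - P - s) + 0 = k + (t - s) by omega] at this
    exact this.symm⟩

/-- A binary word in which the two letters alternate is balanced. -/
lemma countBalanced_of_alternating (hz : ∀ k, z k = i ∨ z k = j) (hij : i ≠ j)
    (h : ∀ k, z (k + 1) ≠ z k) : CountBalanced z i := by
  by_contra hbal
  obtain ⟨p, q, m, hp, hp', hq, hq', hag, -⟩ :=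
    exists_palindrome_of_not_countBalanced hz hij hbal
  have h1 := h p
  have h2 := h q
  rcases Nat.eq_zero_or_pos m with rfl | hm
  · exact h1 (hp'.trans hp.symm)
  · have h3 := hag 0 hm
    simp only [add_zero] at h3
    rcases hz (p + 1) with e | e
    · exact h1 (e.trans hp.symm)
    · exact h2 (by rw [← h3, e, hq])

/-- Sturmian words are balanced. -/
theorem isBalanced_of_isSturmian [Finite A] {w : ℕ → A} (hw : IsSturmian w) : IsBalanced 1 w := by
  have hRS : ∀ n, UniqueRightSpecial w n := fun n =>
    uniqueRightSpecial_of_subwordComplexity (by rw [hw, hw])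
  have hper : ¬ EventuallyPeriodic w := not_eventuallyPeriodic_of_lt fun n _ => by
    rw [hw]; exact Nat.lt_succ_self n
  have key : ∀ i, CountBalanced w i := by
    intro i
    by_cases hi : ∃ p, w p = i
    · obtain ⟨p, hp⟩ := hi
      obtain ⟨q, hq⟩ : ∃ q, w p ≠ w q := by
        by_contra! hcon
        exact hper ⟨0, 1, one_pos, fun k _ => (hcon _).symm.trans (hcon k)⟩
      refine countBalanced_of_uniqueRightSpecial (j := w q) (fun r => ?_) (by rwa [← hp]) hRS hper
      by_contra! hr
      have := (rightSpecial_unique_of_subwordComplexity (n := 0) (p := p) (q := q) (p' := r)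
        (q' := p) (by rw [hw, hw]) (fun k hk => by omega) hq (fun k hk => by omega)
        (by simpa [hp] using hr.1)).2
      simp only [add_zero, hp] at this
      exact this.elim hr.1 hr.2
    · push Not at hi
      have : ∀ n, Nat.count (w · = i) n = 0 := fun n => by
        rw [Nat.count_eq_card_filter_range, Finset.card_eq_zero, Finset.filter_eq_empty_iff]
        exact fun k _ => hi k
      intro p q n
      simp [this]
  rintro n _ ⟨p, rfl⟩ _ ⟨q, rfl⟩ a
  have h1 := key a p q n
  have h2 := key a q p n
  rw [count_factorAt, count_factorAt] at h1 h2
  rw [abs_le]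
  push_cast
  omega

end Binary

/-! ### Words with one branching letter -/

section Branching

variable {A : Type*}

/-- In `w`, the letter `s` is followed by `e` or `f`, both infinitely often, and each other letter
is always followed by the same letter. -/
structure IsBranching (w : ℕ → A) (s e f : A) : Prop where
  next_eq : ∀ p q, w p = w q → w p ≠ s → w (p + 1) = w (q + 1)
  next_or : ∀ p, w p = s → w (p + 1) = e ∨ w (p + 1) = f
  frequently_left : ∀ N, ∃ p, N ≤ p ∧ w p = s ∧ w (p + 1) = e
  frequently_right : ∀ N, ∃ p, N ≤ p ∧ w p = s ∧ w (p + 1) = f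

/-- The first letter of `w` in `T` from position `p` on is at position `m`. -/
def FirstIn (w : ℕ → A) (T : Set A) (p m : ℕ) : Prop :=
  p ≤ m ∧ w m ∈ T ∧ ∀ r, p ≤ r → r < m → w r ∉ T

lemma FirstIn.unique {w : ℕ → A} {T : Set A} {p m m' : ℕ} (h : FirstIn w T p m)
    (h' : FirstIn w T p m') : m = m' := by
  obtain ⟨h1, h2, h3⟩ := h
  obtain ⟨h1', h2', h3'⟩ := h'
  by_contra hne
  rcases lt_or_gt_of_ne hne with hlt | hlt
  · exact h3' m h1 hlt h2
  · exact h3 m' h1' hlt h2'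

lemma FirstIn.mono {w : ℕ → A} {T : Set A} {p q m : ℕ} (h : FirstIn w T p m) (hpq : p ≤ q)
    (hqm : q ≤ m) : FirstIn w T q m :=
  ⟨hqm, h.2.1, fun r hr hrm => h.2.2 r (hpq.trans hr) hrm⟩

/-- The branch of the path from `s` that starts with `g` comes back to `s` without meeting `T`. -/
def AvoidsOnReturn (w : ℕ → A) (T : Set A) (s g : A) : Prop :=
  ∃ t t', w t = s ∧ w (t + 1) = g ∧ t < t' ∧ w t' = s ∧ ∀ r, t < r → r ≤ t' → w r ∉ T

namespace IsBranching

variable {w : ℕ → A} {s e f : A} {T : Set A}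

lemma symm (h : IsBranching w s e f) : IsBranching w s f e :=
  ⟨h.1, fun p hp => (h.2 p hp).symm, h.4, h.3⟩

lemma agree_of_forall_ne (h : IsBranching w s e f) {p q n : ℕ} (hpq : w p = w q)
    (hs : ∀ k < n, w (p + k) ≠ s) : Agree w p q (n + 1) := by
  induction n with
  | zero => exact fun k hk => by obtain rfl : k = 0 := by omega
                                 exact hpq
  | succ n ih =>
    have := ih fun k hk => hs k (by omega)
    exact this.succ (h.next_eq _ _ (this n (by omega)) (hs n (by omega)))

/-- A letter that occurs twice occurs infinitely often: it lies on one of the two branches. -/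
lemma frequently_of_two (h : IsBranching w s e f) {p q : ℕ} (hpq : p < q) (heq : w p = w q)
    (N : ℕ) : ∃ r, N ≤ r ∧ w r = w p := by
  have hs : ∃ t, p ≤ t ∧ t < q ∧ w t = s := by
    by_contra! hcon
    -- Without `s` in between, the word would be periodic and would avoid `s`.
    have hno : ∀ k, w (p + k) ≠ s := by
      intro k
      induction k using Nat.strong_induction_on with
      | _ k ih =>
        by_cases hk : k < q - p
        · exact hcon _ (by omega) (by omega)
        · have := h.agree_of_forall_ne heq (n := k - (q - p)) (fun l hl => ih l (by omega))
            (k - (q - p)) (by omega)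
          rw [show q + (k - (q - p)) = p + k by omega] at this
          rw [← this]
          exact ih _ (by omega)
    obtain ⟨r, hr, hrs, -⟩ := h.frequently_left p
    have := hno (r - p)
    rw [show p + (r - p) = r by omega] at this
    exact this hrs
  classical
  -- Go back from `q` to the last occurrence of `s`.
  have hex : ∃ d, d + 1 ≤ q ∧ w (q - (d + 1)) = s := by
    obtain ⟨t, -, htq, hts⟩ := hs
    exact ⟨q - t - 1, by omega, by rwa [show q - (q - t - 1 + 1) = t by omega]⟩
  obtain ⟨hd, hds⟩ := Nat.find_spec hex
  have hmin : ∀ m < Nat.find hex, ¬ (m + 1 ≤ q ∧ w (q - (m + 1)) = s) :=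
    fun m hm => Nat.find_min hex hm
  set d := Nat.find hex
  obtain ⟨τ, hτ, -, hτg⟩ : ∃ τ, N ≤ τ ∧ w τ = s ∧ w (τ + 1) = w (q - (d + 1) + 1) := by
    rcases h.next_or _ hds with hg | hg
    · rw [hg]; exact h.frequently_left N
    · rw [hg]; exact h.frequently_right N
  have := h.agree_of_forall_ne hτg.symm (n := d) (fun k hk hks => by
    refine hmin (d - k - 1) (by omega) ⟨by omega, ?_⟩
    rwa [show q - (d - k - 1 + 1) = q - (d + 1) + 1 + k by omega]) d (by omega)
  rw [show q - (d + 1) + 1 + d = q by omega] at this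
  exact ⟨τ + 1 + d, by omega, by rw [← this, heq]⟩

lemma eq_of_not_avoidsOnReturn (h : IsBranching w s e f) {g : A}
    (hg : ¬ AvoidsOnReturn w T s g) {t t' m m' : ℕ} (ht : w t = s) (htg : w (t + 1) = g)
    (htg' : w (t' + 1) = g) (hm : FirstIn w T (t + 1) m)
    (hm' : FirstIn w T (t' + 1) m') : w m = w m' := by
  have hag := h.agree_of_forall_ne (htg.trans htg'.symm) (n := m - t - 1) fun k hk hks =>
    hg ⟨t, t + 1 + k, ht, htg, by omega, hks, fun r hr hrk => hm.2.2 r hr (by omega)⟩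
  obtain ⟨hm1, hm2, hm3⟩ := hm
  have hlast := hag (m - t - 1) (by omega)
  rw [show t + 1 + (m - t - 1) = m by omega] at hlast
  have : FirstIn w T (t' + 1) (t' + 1 + (m - t - 1)) := by
    refine ⟨by omega, hlast ▸ hm2, fun r hr hrm => ?_⟩
    have := hag (r - t' - 1) (by omega)
    rw [show t' + 1 + (r - t' - 1) = r by omega] at this
    rw [← this]
    exact hm3 _ (by omega) (by omega)
  rw [hlast, this.unique hm']

lemma exists_return (h : IsBranching w s e f) {g : A} (hg : AvoidsOnReturn w T s g) {τ m : ℕ}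
    (hτg : w (τ + 1) = g) (hm : FirstIn w T (τ + 1) m) :
    ∃ τ', τ < τ' ∧ τ' < m ∧ w τ' = s ∧ FirstIn w T (τ' + 1) m := by
  classical
  obtain ⟨t, t', -, htg, htt', hts', hT⟩ := hg
  have hex : ∃ d, w (t + 1 + d) = s :=
    ⟨t' - t - 1, by rwa [show t + 1 + (t' - t - 1) = t' by omega]⟩
  have hd := Nat.find_spec hex
  have hdle : Nat.find hex ≤ t' - t - 1 :=
    Nat.find_min' hex (by rwa [show t + 1 + (t' - t - 1) = t' by omega])
  have hag := h.agree_of_forall_ne (htg.trans hτg.symm) (n := Nat.find hex)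
    fun k hk => Nat.find_min hex hk
  set d := Nat.find hex
  have hlt : τ + 1 + d < m := by
    by_contra hge
    have hm1 := hm.1
    have := hag (m - τ - 1) (by omega)
    rw [show τ + 1 + (m - τ - 1) = m by omega] at this
    exact hT _ (by omega) (by omega) (this ▸ hm.2.1)
  exact ⟨τ + 1 + d, by omega, hlt, by rw [← hag d (by omega), hd], hm.mono (by omega) (by omega)⟩

/-- When the branch `f` avoids `T`, the next letter of `T` is reached through the branch `e`. -/
lemma exists_through_left (h : IsBranching w s e f) (hf : AvoidsOnReturn w T s f) {t m : ℕ}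
    (ht : w t = s) (hm : FirstIn w T (t + 1) m) :
    ∃ τ, w τ = s ∧ w (τ + 1) = e ∧ FirstIn w T (τ + 1) m := by
  induction hn : m - t using Nat.strong_induction_on generalizing t with
  | _ n ih =>
    rcases h.next_or t ht with hg | hg
    · exact ⟨t, ht, hg, hm⟩
    · obtain ⟨t', htt', htm', hts', hm'⟩ := h.exists_return hf hg hm
      exact ih (m - t') (by omega) hts' hm' rfl

lemma not_avoidsOnReturn (h : IsBranching w s e f) (hf : AvoidsOnReturn w T s f) {t m : ℕ}
    (ht : w t = s) (hm : FirstIn w T (t + 1) m) : ¬ AvoidsOnReturn w T s e := by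
  intro he
  induction hn : m - t using Nat.strong_induction_on generalizing t with
  | _ n ih =>
    rcases h.next_or t ht with hg | hg
    · obtain ⟨t', htt', htm', hts', hm'⟩ := h.exists_return he hg hm
      exact ih (m - t') (by omega) hts' hm' rfl
    · obtain ⟨t', htt', htm', hts', hm'⟩ := h.exists_return hf hg hm
      exact ih (m - t') (by omega) hts' hm' rfl

lemma firstIn_eq_of_avoidsOnReturn (h : IsBranching w s e f) (hf : AvoidsOnReturn w T s f)
    {t m t' m' : ℕ} (ht : w t = s) (ht' : w t' = s) (hm : FirstIn w T (t + 1) m)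
    (hm' : FirstIn w T (t' + 1) m') : w m = w m' := by
  have he := h.not_avoidsOnReturn hf ht hm
  obtain ⟨τ, hτ, hτe, hτm⟩ := h.exists_through_left hf ht hm
  obtain ⟨τ', -, hτe', hτm'⟩ := h.exists_through_left hf ht' hm'
  exact h.eq_of_not_avoidsOnReturn he hτ hτe hτe' hτm hτm'

lemma exists_firstIn (hT : ∀ N, ∃ r, N ≤ r ∧ w r ∈ T) (p : ℕ) : ∃ m, FirstIn w T p m := by
  classical
  have hex : ∃ m, p ≤ m ∧ w m ∈ T := hT p
  exact ⟨Nat.find hex, (Nat.find_spec hex).1, (Nat.find_spec hex).2, fun r hr hrm hrT =>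
    Nat.find_min hex hrm ⟨hr, hrT⟩⟩

/-- Either the first letter of `T` after `s` is always the same, or it depends on the branch that
is taken, and on nothing else. -/
lemma firstIn_dichotomy (h : IsBranching w s e f) (hT : ∀ N, ∃ r, N ≤ r ∧ w r ∈ T) :
    (∀ t m t' m', w t = s → w t' = s → FirstIn w T (t + 1) m → FirstIn w T (t' + 1) m' →
      w m = w m') ∨
    (∀ t m t' m', w t = s → w t' = s → FirstIn w T (t + 1) m → FirstIn w T (t' + 1) m' →
      (w m = w m' ↔ w (t + 1) = w (t' + 1))) := by
  by_cases hf : AvoidsOnReturn w T s f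
  · exact Or.inl fun t m t' m' ht ht' hm hm' => h.firstIn_eq_of_avoidsOnReturn hf ht ht' hm hm'
  by_cases he : AvoidsOnReturn w T s e
  · exact Or.inl fun t m t' m' ht ht' hm hm' =>
      h.symm.firstIn_eq_of_avoidsOnReturn he ht ht' hm hm'
  obtain ⟨a, -, has, hae⟩ := h.frequently_left 0
  obtain ⟨b, -, hbs, hbf⟩ := h.frequently_right 0
  obtain ⟨ma, hma⟩ := exists_firstIn hT (a + 1)
  obtain ⟨mb, hmb⟩ := exists_firstIn hT (b + 1)
  have Ha : ∀ t m, w (t + 1) = e → FirstIn w T (t + 1) m → w m = w ma :=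
    fun t m hte hm => (h.eq_of_not_avoidsOnReturn he has hae hte hma hm).symm
  have Hb : ∀ t m, w (t + 1) = f → FirstIn w T (t + 1) m → w m = w mb :=
    fun t m htf hm => (h.eq_of_not_avoidsOnReturn hf hbs hbf htf hmb hm).symm
  by_cases hab : w ma = w mb
  · refine Or.inl fun t m t' m' ht ht' hm hm' => ?_
    rcases h.next_or t ht with hg | hg <;> rcases h.next_or t' ht' with hg' | hg'
    · rw [Ha t m hg hm, Ha t' m' hg' hm']
    · rw [Ha t m hg hm, Hb t' m' hg' hm', hab]
    · rw [Hb t m hg hm, Ha t' m' hg' hm', hab]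
    · rw [Hb t m hg hm, Hb t' m' hg' hm']
  · have hef : e ≠ f := by
      rintro rfl
      exact hab (Hb a ma hae hma)
    refine Or.inr fun t m t' m' ht ht' hm hm' => ?_
    rcases h.next_or t ht with hg | hg <;> rcases h.next_or t' ht' with hg' | hg'
    · rw [Ha t m hg hm, Ha t' m' hg' hm', hg, hg']; simp
    · rw [Ha t m hg hm, Hb t' m' hg' hm', hg, hg']; simp [hab, hef]
    · rw [Hb t m hg hm, Ha t' m' hg' hm', hg, hg']; simp [Ne.symm hab, hef.symm]
    · rw [Hb t m hg hm, Hb t' m' hg' hm', hg, hg']; simp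

/-- Two paths from the same letter to the next letter of `T` are equal, unless they part at an
occurrence of `s`. -/
lemma agree_or_part (h : IsBranching w s e f) {p q m m' : ℕ} (hpq : w p = w q)
    (hm : FirstIn w T (p + 1) m) (hm' : FirstIn w T (q + 1) m') :
    (∃ g, m = p + g ∧ m' = q + g ∧ Agree w p q (g + 1)) ∨
    ∃ r, p + r < m ∧ q + r < m' ∧ Agree w p q (r + 1) ∧ w (p + r) = s ∧
      w (p + r + 1) ≠ w (q + r + 1) := by
  classical
  obtain ⟨h1, h2, h3⟩ := hm
  by_cases hag : Agree w p q (m - p + 1)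
  · left
    refine ⟨m - p, by omega, ?_, hag⟩
    refine hm'.unique ⟨by omega, ?_, fun r hr hrm => ?_⟩
    · rw [← hag (m - p) (by omega), show p + (m - p) = m by omega]
      exact h2
    · have := hag (r - q) (by omega)
      rw [show q + (r - q) = r by omega] at this
      rw [← this]
      exact h3 _ (by omega) (by omega)
  · right
    have hex : ∃ k, w (p + k) ≠ w (q + k) := by
      unfold Agree at hag
      push Not at hag
      obtain ⟨k, -, hk⟩ := hag
      exact ⟨k, hk⟩
    have hk := Nat.find_spec hex
    have hmin : Agree w p q (Nat.find hex) := fun k hk => not_not.1 (Nat.find_min hex hk)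
    set k := Nat.find hex
    have hk0 : k ≠ 0 := by
      intro e0
      rw [e0] at hk
      exact hk hpq
    have hkm : k < m - p + 1 := by
      by_contra hge
      exact hag (hmin.mono (by omega))
    have hpr : p + (k - 1) + 1 = p + k := by omega
    have hqr : q + (k - 1) + 1 = q + k := by omega
    refine ⟨k - 1, by omega, ?_, hmin.mono (by omega), ?_, by rwa [hpr, hqr]⟩
    · by_contra hge
      obtain ⟨h1', h2', -⟩ := hm'
      have := hmin (m' - q) (by omega)
      rw [show q + (m' - q) = m' by omega] at this
      exact h3 _ (by omega) (by omega) (this ▸ h2')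
    · by_contra hne
      have := h.next_eq _ _ (hmin (k - 1) (by omega)) hne
      rw [hpr, hqr] at this
      exact hk this

end IsBranching

end Branching

/-! ### Projections to the letters of a subset -/

section Projection

variable {A : Type*}

open Classical in
/-- The word that is left of `w` when the letters outside `T` are deleted. The definition makes
sense when letters of `T` occur infinitely often. -/
noncomputable def project (w : ℕ → A) (T : Set A) (k : ℕ) : A :=
  w (Nat.nth (w · ∈ T) k)

variable {w : ℕ → A} {T : Set A}

lemma infinite_setOf_mem (hT : ∀ N, ∃ r, N ≤ r ∧ w r ∈ T) : (Set.ofPred (w · ∈ T)).Infinite :=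
  Set.infinite_of_forall_exists_gt fun N => by
    obtain ⟨r, hr, hrT⟩ := hT (N + 1)
    exact ⟨r, hrT, hr⟩

lemma project_mem (hT : ∀ N, ∃ r, N ≤ r ∧ w r ∈ T) (k : ℕ) : project w T k ∈ T :=
  Nat.nth_mem_of_infinite (infinite_setOf_mem hT) k

open Classical in
lemma project_count {r : ℕ} (hr : w r ∈ T) : project w T (Nat.count (w · ∈ T) r) = w r := by
  rw [project, Nat.nth_count (p := (w · ∈ T)) hr]

open Classical in
lemma firstIn_nth_succ (hT : ∀ N, ∃ r, N ≤ r ∧ w r ∈ T) (k : ℕ) :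
    FirstIn w T (Nat.nth (w · ∈ T) k + 1) (Nat.nth (w · ∈ T) (k + 1)) := by
  have hmono := Nat.nth_strictMono (infinite_setOf_mem hT)
  refine ⟨hmono (Nat.lt_succ_self k), project_mem hT _, fun r hr hrk hrT => ?_⟩
  rw [← Nat.nth_count (p := (w · ∈ T)) hrT] at hr hrk
  have h1 := hmono.lt_iff_lt.1 (Nat.lt_of_succ_le hr)
  have h2 := hmono.lt_iff_lt.1 hrk
  omega

open Classical in
lemma count_add_of_agree {p q n : ℕ} (h : Agree w p q n) {r : ℕ} (hr : r ≤ n) :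
    Nat.count (w · ∈ T) (p + r) + Nat.count (w · ∈ T) q =
      Nat.count (w · ∈ T) (q + r) + Nat.count (w · ∈ T) p := by
  induction r with
  | zero => simp; omega
  | succ r ih =>
    have := ih (by omega)
    rw [← add_assoc, ← add_assoc, Nat.count_succ, Nat.count_succ, h r (by omega)]
    omega

open Classical in
lemma count_project [DecidableEq A] {i : A} (hi : i ∈ T) (p : ℕ) :
    Nat.count (project w T · = i) (Nat.count (w · ∈ T) p) = Nat.count (w · = i) p := by
  induction p with
  | zero => simp
  | succ p ih =>
    rw [Nat.count_succ, Nat.count_succ (w · = i)]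
    by_cases hp : w p ∈ T
    · rw [if_pos hp, Nat.count_succ, ih, project_count hp]
    · rw [if_neg hp, add_zero, ih, if_neg (by rintro rfl; exact hp hi), add_zero]

lemma count_add_count [DecidableEq A] {z : ℕ → A} {i j : A} (hz : ∀ k, z k = i ∨ z k = j)
    (hij : i ≠ j) (n : ℕ) : Nat.count (z · = i) n + Nat.count (z · = j) n = n := by
  induction n with
  | zero => simp
  | succ n ih =>
    rw [Nat.count_succ, Nat.count_succ]
    rcases hz n with e | e
    · simp [e, hij]; omega
    · simp [e, hij.symm]; omega

lemma pairBalanced_of_countBalanced_project [DecidableEq A] {i j : A} (hij : i ≠ j)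
    (hT : ∀ N, ∃ r, N ≤ r ∧ w r ∈ ({i, j} : Set A)) (h : CountBalanced (project w {i, j}) i) :
    PairBalanced w i j := by
  classical
  have hi : i ∈ ({i, j} : Set A) := by simp
  have hj : j ∈ ({i, j} : Set A) := by simp
  have hz : ∀ k, project w {i, j} k = i ∨ project w {i, j} k = j := fun k => project_mem hT k
  generalize ({i, j} : Set A) = T at *
  intro p p' q q' hp hq
  simp only [← count_project (w := w) hi,
    ← count_project (w := w) hj]
  have hp := Nat.count_monotone (w · ∈ T) hp
  have hq := Nat.count_monotone (w · ∈ T) hq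
  revert hp hq
  generalize Nat.count (w · ∈ T) p = P
  generalize Nat.count (w · ∈ T) p' = P'
  generalize Nat.count (w · ∈ T) q = Q
  generalize Nat.count (w · ∈ T) q' = Q'
  intro hP hQ h1 h2
  have hsum := count_add_count (z := project w T) hz hij
  have hm := Nat.count_monotone (project w T · = i)
  have hm' := Nat.count_monotone (project w T · = j)
  rcases le_total (P' - P) (Q' - Q) with hle | hle
  · -- Shorten the second factor.
    have := h P Q (P' - P)
    rw [show P + (P' - P) = P' by omega] at this
    have := hm (show Q + (P' - P) ≤ Q' by omega)
    omega
  · have := h P Q (Q' - Q)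
    rw [show Q + (Q' - Q) = Q' by omega] at this
    have e1 := hsum P
    have e2 := hsum (P + (Q' - Q))
    have e3 := hsum Q
    have e4 := hsum Q'
    have := hm' (show P + (Q' - Q) ≤ P' by omega)
    omega

end Projection

/-! ### Words of complexity `n + c` -/

section QuasiSturmian

variable {A : Type*} {w : ℕ → A} {s e f : A} {T : Set A}

open Classical in
/-- A factor of the projection determines the path in `w` between its first and last letters. -/
lemma IsBranching.lift_agree (h : IsBranching w s e f) (hT : ∀ N, ∃ r, N ≤ r ∧ w r ∈ T)
    (hV : ∀ t m t' m', w t = s → w t' = s → FirstIn w T (t + 1) m → FirstIn w T (t' + 1) m' →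
      (w m = w m' ↔ w (t + 1) = w (t' + 1))) {k l n : ℕ}
    (hkl : Agree (project w T) k l (n + 1)) :
    ∃ g, Nat.nth (w · ∈ T) (k + n) = Nat.nth (w · ∈ T) k + g ∧
      Nat.nth (w · ∈ T) (l + n) = Nat.nth (w · ∈ T) l + g ∧
      Agree w (Nat.nth (w · ∈ T) k) (Nat.nth (w · ∈ T) l) (g + 1) := by
  induction n with
  | zero =>
    refine ⟨0, rfl, rfl, fun r hr => ?_⟩
    obtain rfl : r = 0 := by omega
    exact hkl 0 (by omega)
  | succ n ih =>
    obtain ⟨g, hg, hg', hag⟩ := ih (hkl.mono (by omega))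
    have hm := firstIn_nth_succ hT (k + n)
    have hm' := firstIn_nth_succ hT (l + n)
    rcases h.agree_or_part (hkl n (by omega)) hm hm' with
      ⟨a, ha, ha', hag'⟩ | ⟨r, hr, hr', hag', hs, hne⟩
    · refine ⟨g + a, ?_, ?_, fun t ht => ?_⟩
      · rw [← add_assoc, ha, hg]; omega
      · rw [← add_assoc, ha', hg']; omega
      · by_cases htg : t < g + 1
        · exact hag t htg
        · have := hag' (t - g) (by omega)
          rwa [hg, hg', add_assoc, add_assoc, show g + (t - g) = t by omega] at this
    · refine absurd ?_ hne
      exact (hV _ _ _ _ hs ((hag' r (by omega)).symm.trans hs) (hm.mono (by omega) (by omega))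
        (hm'.mono (by omega) (by omega))).1 (hkl (n + 1) (by omega))

open Classical in
/-- A right special factor of length `n` of the projection extends to a right special factor of
`w` that starts with a letter of `T` and has `n` letters in `T`. -/
lemma IsBranching.lift_rightSpecial (h : IsBranching w s e f) (hT : ∀ N, ∃ r, N ≤ r ∧ w r ∈ T)
    (hV : ∀ t m t' m', w t = s → w t' = s → FirstIn w T (t + 1) m → FirstIn w T (t' + 1) m' →
      (w m = w m' ↔ w (t + 1) = w (t' + 1))) {k l n : ℕ}
    (hkl : Agree (project w T) k l (n + 1))
    (hne : project w T (k + (n + 1)) ≠ project w T (l + (n + 1))) :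
    ∃ H, 0 < H ∧ Agree w (Nat.nth (w · ∈ T) k) (Nat.nth (w · ∈ T) l) H ∧
      w (Nat.nth (w · ∈ T) k + H) ≠ w (Nat.nth (w · ∈ T) l + H) ∧
      Nat.count (w · ∈ T) (Nat.nth (w · ∈ T) k + H) = k + (n + 1) := by
  obtain ⟨g, hg, hg', hag⟩ := h.lift_agree hT hV hkl
  have hm := firstIn_nth_succ hT (k + n)
  have hm' := firstIn_nth_succ hT (l + n)
  rcases h.agree_or_part (hkl n (by omega)) hm hm' with
    ⟨a, ha, ha', hag'⟩ | ⟨r, hr, hr', hag', -, hr''⟩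
  · refine absurd ?_ hne
    have := hag' a (by omega)
    rwa [← ha, ← ha'] at this
  · refine ⟨g + r + 1, by omega, fun t ht => ?_, ?_, ?_⟩
    · by_cases htg : t < g + 1
      · exact hag t htg
      · have := hag' (t - g) (by omega)
        rwa [hg, hg', add_assoc, add_assoc, show g + (t - g) = t by omega] at this
    · rw [hg, hg'] at hr''
      simpa only [add_assoc] using hr''
    · apply le_antisymm
      · refine (Nat.count_le_iff_le_nth (infinite_setOf_mem hT)).2 ?_
        rw [← add_assoc k n 1]
        omega
      · refine Nat.succ_le_of_lt ((Nat.lt_nth_iff_count_lt (infinite_setOf_mem hT)).2 ?_)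
        change Nat.nth (w · ∈ T) (k + n) < _
        omega

open Classical in
lemma IsBranching.uniqueRightSpecial_project (h : IsBranching w s e f)
    (hRS : ∀ n, 0 < n → UniqueRightSpecial w n) (hT : ∀ N, ∃ r, N ≤ r ∧ w r ∈ T)
    (hV : ∀ t m t' m', w t = s → w t' = s → FirstIn w T (t + 1) m → FirstIn w T (t' + 1) m' →
      (w m = w m' ↔ w (t + 1) = w (t' + 1))) (n : ℕ) :
    UniqueRightSpecial (project w T) n := by
  intro k l k' l' hkl hne hkl' hne'
  rcases n with _ | n
  · exact fun r hr => by omega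
  obtain ⟨H, hH, hag, hne, hcount⟩ := h.lift_rightSpecial hT hV hkl hne
  obtain ⟨H', hH', hag', hne', hcount'⟩ := h.lift_rightSpecial hT hV hkl' hne'
  -- It suffices to treat the case where the first lifted factor is not longer than the second.
  have main : ∀ {k k' l l' H H' : ℕ}, 0 < H → H ≤ H' →
      Agree w (Nat.nth (w · ∈ T) k) (Nat.nth (w · ∈ T) l) H →
      w (Nat.nth (w · ∈ T) k + H) ≠ w (Nat.nth (w · ∈ T) l + H) →
      Nat.count (w · ∈ T) (Nat.nth (w · ∈ T) k + H) = k + (n + 1) →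
      Agree w (Nat.nth (w · ∈ T) k') (Nat.nth (w · ∈ T) l') H' →
      w (Nat.nth (w · ∈ T) k' + H') ≠ w (Nat.nth (w · ∈ T) l' + H') →
      Nat.count (w · ∈ T) (Nat.nth (w · ∈ T) k' + H') = k' + (n + 1) →
      Agree (project w T) k k' (n + 1) := by
    clear! k k' l l' H H'
    intro k k' l l' H H' hH hHH' hag hne hcount hag' hne' hcount'
    have hcn : ∀ m, Nat.count (w · ∈ T) (Nat.nth (w · ∈ T) m) = m :=
      Nat.count_nth_of_infinite (infinite_setOf_mem hT)
    have hsuf := hRS H hH _ _ (Nat.nth (w · ∈ T) k' + (H' - H))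
      (Nat.nth (w · ∈ T) l' + (H' - H)) hag hne
      (Agree.drop (H' - H) (by rwa [show H' - H + H = H' by omega]))
      (by rwa [add_assoc, add_assoc, show H' - H + H = H' by omega])
    -- Both lifted factors have `n + 1` letters in `T` and start with such a letter, so that
    -- neither is a proper suffix of the other.
    have hlen : H' - H = 0 := by
      have h1 := count_add_of_agree (T := T) hsuf le_rfl
      rw [hcount, add_assoc _ (H' - H) H, show H' - H + H = H' by omega, hcount', hcn] at h1
      have h2 := (Nat.count_le_iff_le_nth (infinite_setOf_mem hT) (a := Nat.nth (w · ∈ T) k' +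
        (H' - H)) (b := k')).1 (by omega)
      omega
    rw [hlen, add_zero] at hsuf
    intro r hr
    have hmono := Nat.nth_strictMono (infinite_setOf_mem hT)
    have hle : Nat.nth (w · ∈ T) k ≤ Nat.nth (w · ∈ T) (k + r) := hmono.monotone (by omega)
    have hlt : Nat.nth (w · ∈ T) (k + r) < Nat.nth (w · ∈ T) k + H :=
      (Nat.lt_nth_iff_count_lt (infinite_setOf_mem hT)).1 (by omega)
    obtain ⟨x, hx⟩ := Nat.exists_eq_add_of_le hle
    have hwx := hsuf x (by omega)
    rw [← hx] at hwx
    have hmem : w (Nat.nth (w · ∈ T) k' + x) ∈ T := hwx ▸ project_mem hT (k + r)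
    have hc := count_add_of_agree (T := T) hsuf (r := x) (by omega)
    rw [← hx, hcn, hcn, hcn] at hc
    have hcx : Nat.count (w · ∈ T) (Nat.nth (w · ∈ T) k' + x) = k' + r := by omega
    rw [← hcx, project_count hmem, ← hwx]
    rfl
  rcases le_total H H' with hle | hle
  · exact main hH hle hag hne hcount hag' hne' hcount'
  · exact (main hH' hle hag' hne' hcount' hag hne hcount).symm

open Classical in
lemma IsBranching.not_eventuallyPeriodic_project (h : IsBranching w s e f)
    (hper : ¬ EventuallyPeriodic w) (hT : ∀ N, ∃ r, N ≤ r ∧ w r ∈ T)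
    (hV : ∀ t m t' m', w t = s → w t' = s → FirstIn w T (t + 1) m → FirstIn w T (t' + 1) m' →
      (w m = w m' ↔ w (t + 1) = w (t' + 1))) :
    ¬ EventuallyPeriodic (project w T) := by
  rintro ⟨N, d, hd, hz⟩
  have hmono := Nat.nth_strictMono (infinite_setOf_mem hT)
  have hlt := hmono (show N < N + d by omega)
  refine hper ⟨Nat.nth (w · ∈ T) N, Nat.nth (w · ∈ T) (N + d) - Nat.nth (w · ∈ T) N, by omega,
    fun t ht => ?_⟩
  obtain ⟨g, hg, -, hag⟩ := h.lift_agree hT hV (k := N) (l := N + d) (n := t) fun r _ => by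
    rw [← hz (N + r) (by omega), add_right_comm]
  have hge := hmono.le_apply (x := N + t)
  have := hag (t - Nat.nth (w · ∈ T) N) (by omega)
  rw [show Nat.nth (w · ∈ T) N + (t - Nat.nth (w · ∈ T) N) = t by omega,
    show Nat.nth (w · ∈ T) (N + d) + (t - Nat.nth (w · ∈ T) N) =
      t + (Nat.nth (w · ∈ T) (N + d) - Nat.nth (w · ∈ T) N) by omega] at this
  exact this.symm

variable [DecidableEq A]

lemma exists_lt_of_count_add_two_le {i : A} {a b : ℕ}
    (h : Nat.count (w · = i) a + 2 ≤ Nat.count (w · = i) b) : ∃ p q, p < q ∧ w p = i ∧ w q = i := by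
  have h2 : 1 < Nat.count (w · = i) b := by omega
  rw [Nat.count_eq_card_filter_range, Finset.one_lt_card] at h2
  obtain ⟨p, hp, q, hq, hpq⟩ := h2
  simp only [Finset.mem_filter, Finset.mem_range] at hp hq
  rcases lt_or_gt_of_ne hpq with hlt | hlt
  · exact ⟨p, q, hlt, hp.2, hq.2⟩
  · exact ⟨q, p, hlt, hq.2, hp.2⟩

lemma IsBranching.pairBalanced (h : IsBranching w s e f) (hper : ¬ EventuallyPeriodic w)
    (hRS : ∀ n, 0 < n → UniqueRightSpecial w n) {i j : A} (hij : i ≠ j) : PairBalanced w i j := by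
  -- Two unbalanced factors provide two occurrences of `i` and two occurrences of `j`.
  by_contra hcon
  have hcon' := hcon
  unfold PairBalanced at hcon'
  push Not at hcon'
  obtain ⟨p, p', q, q', hpp, hqq, h1, h2, -⟩ := hcon'
  have hi : ∀ N, ∃ r, N ≤ r ∧ w r = i := by
    have := Nat.count_monotone (w · = i) hqq
    obtain ⟨a, b, hab, ha, hb⟩ := exists_lt_of_count_add_two_le (w := w) (i := i) (a := p) (b := p')
      (by omega)
    intro N
    obtain ⟨r, hr, hrw⟩ := h.frequently_of_two hab (ha.trans hb.symm) N
    exact ⟨r, hr, hrw.trans ha⟩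
  have hj : ∀ N, ∃ r, N ≤ r ∧ w r = j := by
    have := Nat.count_monotone (w · = j) hpp
    obtain ⟨a, b, hab, ha, hb⟩ := exists_lt_of_count_add_two_le (w := w) (i := j) (a := q) (b := q')
      (by omega)
    intro N
    obtain ⟨r, hr, hrw⟩ := h.frequently_of_two hab (ha.trans hb.symm) N
    exact ⟨r, hr, hrw.trans ha⟩
  have hT : ∀ N, ∃ r, N ≤ r ∧ w r ∈ ({i, j} : Set A) := fun N => by
    obtain ⟨r, hr, hri⟩ := hi N
    exact ⟨r, hr, Or.inl hri⟩
  have hz : ∀ k, project w {i, j} k = i ∨ project w {i, j} k = j := fun k => project_mem hT k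
  refine hcon (pairBalanced_of_countBalanced_project hij hT ?_)
  rcases h.firstIn_dichotomy hT with hU | hV
  · -- In the projection, each letter determines the next one, so that the two letters alternate.
    refine countBalanced_of_alternating hz hij fun k hk => ?_
    have hstep : ∀ a b, project w {i, j} a = project w {i, j} b →
        project w {i, j} (a + 1) = project w {i, j} (b + 1) := by
      intro a b hab
      rcases h.agree_or_part hab (firstIn_nth_succ hT a) (firstIn_nth_succ hT b) with
        ⟨g, hg, hg', hag⟩ | ⟨r, hr, hr', hag, hs, -⟩
      · have := hag g (by omega)
        rwa [← hg, ← hg'] at this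
      · exact hU _ _ _ _ hs ((hag r (by omega)).symm.trans hs)
          ((firstIn_nth_succ hT a).mono (by omega) (by omega))
          ((firstIn_nth_succ hT b).mono (by omega) (by omega))
    have hconst : ∀ l, project w {i, j} (k + l) = project w {i, j} k := by
      intro l
      induction l with
      | zero => rfl
      | succ l ih => exact (hstep _ _ ih).trans hk
    classical
    have hocc : ∀ c ∈ ({i, j} : Set A), (∀ N, ∃ r, N ≤ r ∧ w r = c) →
        project w {i, j} k = c := by
      intro c hc hinf
      generalize ({i, j} : Set A) = T at *
      obtain ⟨r, hr, hrc⟩ := hinf (Nat.nth (w · ∈ T) k)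
      have hmono := Nat.count_monotone (w · ∈ T) hr
      rw [Nat.count_nth_of_infinite (infinite_setOf_mem hT)] at hmono
      rw [← hrc, ← project_count (w := w) (T := T) (r := r) (hrc ▸ hc),
        ← hconst (Nat.count (w · ∈ T) r - k)]
      congr 1
      omega
    exact hij ((hocc i (by simp) hi).symm.trans (hocc j (by simp) hj))
  · exact countBalanced_of_uniqueRightSpecial hz hij (h.uniqueRightSpecial_project hRS hT hV)
      (h.not_eventuallyPeriodic_project hper hT hV)

omit [DecidableEq A] in
lemma exists_isBranching [Finite A] (hper : ¬ EventuallyPeriodic w)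
    (h2 : subwordComplexity w 2 ≤ subwordComplexity w 1 + 1) : ∃ s e f, IsBranching w s e f := by
  obtain ⟨p, q, -, -, hpq, hne⟩ := exists_rightSpecial hper 0 1
  have hag : ∀ {r r'}, w r = w r' → Agree w r r' 1 := fun h k hk => by
    obtain rfl : k = 0 := by omega
    exact h
  have hnext : ∀ r r', w r = w r' → w r ≠ w p → w (r + 1) = w (r' + 1) := by
    intro r r' hr hrp
    by_contra hne'
    exact hrp ((rightSpecial_unique_of_subwordComplexity h2 hpq hne (hag hr) hne').1 0
      one_pos).symm
  have hor : ∀ r, w r = w p → w (r + 1) = w (p + 1) ∨ w (r + 1) = w (q + 1) := by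
    intro r hr
    by_cases hr1 : w (r + 1) = w (p + 1)
    · exact Or.inl hr1
    · exact (rightSpecial_unique_of_subwordComplexity h2 hpq hne (hag hr) hr1).2
  have hfreq : ∀ N, ∃ r r', N ≤ r ∧ N ≤ r' ∧ w r = w p ∧ w r' = w p ∧
      w (r + 1) ≠ w (r' + 1) := by
    intro N
    obtain ⟨r, r', hr, hr', hrr, hne'⟩ := exists_rightSpecial hper N 1
    have hrr : w r = w r' := hrr 0 one_pos
    have hrp : w r = w p := by
      by_contra hrp
      exact hne' (hnext r r' hrr hrp)
    exact ⟨r, r', hr, hr', hrp, hrr ▸ hrp, hne'⟩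
  refine ⟨w p, w (p + 1), w (q + 1), hnext, hor, fun N => ?_, fun N => ?_⟩ <;>
  · obtain ⟨r, r', hr, hr', hrp, hrp', hne'⟩ := hfreq N
    rcases hor r hrp with e1 | e1 <;> rcases hor r' hrp' with e2 | e2
    · exact absurd (e1.trans e2.symm) hne'
    · first | exact ⟨r, hr, hrp, e1⟩ | exact ⟨r', hr', hrp', e2⟩
    · first | exact ⟨r, hr, hrp, e1⟩ | exact ⟨r', hr', hrp', e2⟩
    · exact absurd (e1.trans e2.symm) hne'

/-- The case of words of complexity `n + c`. -/
theorem kBinomialComplexity_eq_of_subwordComplexity [Finite A] {c : ℕ} (hc : 0 < c)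
    (hw : ∀ n, 0 < n → subwordComplexity w n = n + c) :
    kBinomialComplexity 2 w = subwordComplexity w := by
  have hper : ¬ EventuallyPeriodic w := not_eventuallyPeriodic_of_lt fun n hn => by
    rw [hw n hn]; omega
  obtain ⟨s, e, f, h⟩ := exists_isBranching hper (by
    rw [hw 1 one_pos, hw 2 two_pos]; omega)
  refine kBinomialComplexity_eq_of_pairBalanced fun i j hij => h.pairBalanced hper ?_ hij
  exact fun n hn => uniqueRightSpecial_of_subwordComplexity (by
    rw [hw n hn, hw (n + 1) n.succ_pos]; omega)

end QuasiSturmian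

/-! ### Billiard words -/

section Billiard

lemma exists_last_of_count_lt {A : Type*} [DecidableEq A] {w : ℕ → A} {i : A} {p q : ℕ}
    (hpq : p ≤ q) (h : Nat.count (w · = i) p < Nat.count (w · = i) q) :
    ∃ r, p ≤ r ∧ r < q ∧ w r = i ∧ Nat.count (w · = i) r + 1 = Nat.count (w · = i) q := by
  induction q, hpq using Nat.le_induction with
  | base => omega
  | succ q hpq ih =>
    by_cases hq : w q = i
    · exact ⟨q, hpq, Nat.lt_succ_self q, hq, by rw [Nat.count_succ, if_pos hq]⟩
    · rw [Nat.count_succ, if_neg hq, add_zero] at h ⊢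
      obtain ⟨r, h1, h2, h3, h4⟩ := ih h
      exact ⟨r, h1, by omega, h3, h4⟩

/-- The inequality that makes the merge of two arithmetic progressions balanced. The `k`-th letter
`i` is scheduled at time `a i + k * b i`, with `k` counted from `0`, the letters are listed in the
order of time, and `le i j` holds when a letter `i` precedes a simultaneous letter `j`. The letters
`i` at positions in `[p, p')` are scheduled between the last letter `j` before `p` (a virtual one,
at time `a j - b j`, when there is none) and the first letter `j` from `p'` on. -/
lemma mul_count_le_of_merge {A : Type*} [DecidableEq A] {w : ℕ → A} {i j : A} {a b : A → ℝ}
    {le : A → A → Prop} (hai : 0 ≤ a i) (haj : a j ≤ b j) (hbi : 0 ≤ b i) (hbj : 0 ≤ b j)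
    (hi : ∀ n, w n = i → a i + Nat.count (w · = i) n * b i ≤ a j + Nat.count (w · = j) n * b j ∧
      (a i + Nat.count (w · = i) n * b i = a j + Nat.count (w · = j) n * b j → le i j))
    (hj : ∀ n, w n = j → a j + Nat.count (w · = j) n * b j ≤ a i + Nat.count (w · = i) n * b i)
    {p p' : ℕ} (hpp : p ≤ p') (hlt : Nat.count (w · = i) p < Nat.count (w · = i) p') :
    ((Nat.count (w · = i) p' : ℝ) - Nat.count (w · = i) p - 1) * b i ≤
      ((Nat.count (w · = j) p' : ℝ) - Nat.count (w · = j) p + 1) * b j ∧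
    (((Nat.count (w · = i) p' : ℝ) - Nat.count (w · = i) p - 1) * b i =
      ((Nat.count (w · = j) p' : ℝ) - Nat.count (w · = j) p + 1) * b j → le i j) := by
  obtain ⟨r, hpr, hrp, hr, hcr⟩ := exists_last_of_count_lt hpp hlt
  obtain ⟨h1, h1'⟩ := hi r hr
  have hmono : (Nat.count (w · = j) r : ℝ) * b j ≤ Nat.count (w · = j) p' * b j :=
    mul_le_mul_of_nonneg_right (by exact_mod_cast Nat.count_monotone _ hrp.le) hbj
  have hcr' : (Nat.count (w · = i) p' : ℝ) = Nat.count (w · = i) r + 1 := by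
    exact_mod_cast hcr.symm
  have hprev : a j + ((Nat.count (w · = j) p : ℝ) - 1) * b j ≤
      a i + Nat.count (w · = i) p * b i := by
    rcases Nat.eq_zero_or_pos (Nat.count (w · = j) p) with h0 | h0
    · rw [h0]
      have : 0 ≤ (Nat.count (w · = i) p : ℝ) * b i := by positivity
      push_cast
      linarith
    · obtain ⟨t, -, htp, ht, hct⟩ := exists_last_of_count_lt (w := w) (i := j) (Nat.zero_le p)
        (by simpa using h0)
      have h2 := hj t ht
      have hmono' : (Nat.count (w · = i) t : ℝ) * b i ≤ Nat.count (w · = i) p * b i :=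
        mul_le_mul_of_nonneg_right (by exact_mod_cast Nat.count_monotone _ htp.le) hbi
      have hct' : (Nat.count (w · = j) p : ℝ) = Nat.count (w · = j) t + 1 := by
        exact_mod_cast hct.symm
      rw [hct', add_sub_cancel_right]
      linarith
  rw [hcr']
  constructor
  · linarith
  · intro heq
    exact h1' (by linarith)

lemma pairBalanced_of_merge {A : Type*} [DecidableEq A] {w : ℕ → A} {i j : A} {a b : A → ℝ}
    {le : A → A → Prop} (hle : ¬ (le i j ∧ le j i)) (hai : 0 ≤ a i) (haj : 0 ≤ a j)
    (hai' : a i ≤ b i) (haj' : a j ≤ b j)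
    (hi : ∀ n, w n = i → a i + Nat.count (w · = i) n * b i ≤ a j + Nat.count (w · = j) n * b j ∧
      (a i + Nat.count (w · = i) n * b i = a j + Nat.count (w · = j) n * b j → le i j))
    (hj : ∀ n, w n = j → a j + Nat.count (w · = j) n * b j ≤ a i + Nat.count (w · = i) n * b i ∧
      (a j + Nat.count (w · = j) n * b j = a i + Nat.count (w · = i) n * b i → le j i)) :
    PairBalanced w i j := by
  intro p p' q q' hp hq h1 h2
  have hbi := hai.trans hai'
  have hbj := haj.trans haj'
  have m1 := Nat.count_monotone (w · = i) hq
  have m2 := Nat.count_monotone (w · = j) hp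
  obtain ⟨e1, e1'⟩ := mul_count_le_of_merge hai haj' hbi hbj hi (fun n hn => (hj n hn).1) hp
    (by omega)
  obtain ⟨e2, e2'⟩ := mul_count_le_of_merge haj hai' hbj hbi hj (fun n hn => (hi n hn).1) hq
    (by omega)
  have c1 : (Nat.count (w · = i) q' : ℝ) + Nat.count (w · = i) p + 2 ≤
      Nat.count (w · = i) p' + Nat.count (w · = i) q := by exact_mod_cast h1
  have c2 : (Nat.count (w · = j) p' : ℝ) + Nat.count (w · = j) q + 2 ≤
      Nat.count (w · = j) q' + Nat.count (w · = j) p := by exact_mod_cast h2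
  -- The four quantities form a cycle of inequalities, so they are equal.
  have f1 : ((Nat.count (w · = j) p' : ℝ) - Nat.count (w · = j) p + 1) * b j ≤
      ((Nat.count (w · = j) q' : ℝ) - Nat.count (w · = j) q - 1) * b j :=
    mul_le_mul_of_nonneg_right (by linarith) hbj
  have f2 : ((Nat.count (w · = i) q' : ℝ) - Nat.count (w · = i) q + 1) * b i ≤
      ((Nat.count (w · = i) p' : ℝ) - Nat.count (w · = i) p - 1) * b i :=
    mul_le_mul_of_nonneg_right (by linarith) hbi
  exact hle ⟨e1' (by linarith), e2' (by linarith)⟩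

variable {d : ℕ}

/-- The distance, along an axis, from the coordinate `x` of the ball to the hyperface towards which
it moves when its velocity along this axis is `v ≠ 0`. -/
noncomputable def distToFace (x v : ℝ) : ℝ :=
  if 0 < v then 1 - x else x

lemma distToFace_add_mul {x v t : ℝ} : distToFace (x + t * v) v = distToFace x v - t * |v| := by
  unfold distToFace
  split_ifs with h
  · rw [abs_of_pos h]; ring
  · rw [abs_of_nonpos (not_lt.1 h)]; ring

lemma hits_iff {p v : Fin d → ℝ} {i : Fin d} :
    Hits p v i ↔ v i ≠ 0 ∧ distToFace (p i) (v i) = 0 := by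
  unfold Hits distToFace
  rcases lt_trichotomy (v i) 0 with h | h | h
  · simp [h, h.ne, not_lt.2 h.le]
  · simp [h]
  · simp [h, h.ne', not_lt.2 h.le, sub_eq_zero, eq_comm (a := p i)]

lemma distToFace_nonneg {p : Fin d → ℝ} (hp : p ∈ unitCube d) (v : ℝ) (i : Fin d) :
    0 ≤ distToFace (p i) v := by
  have := hp i
  unfold distToFace
  split_ifs <;> linarith

lemma distToFace_le_one {p : Fin d → ℝ} (hp : p ∈ unitCube d) (v : ℝ) (i : Fin d) :
    distToFace (p i) v ≤ 1 := by
  have := hp i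
  unfold distToFace
  split_ifs <;> linarith

/-- When the ball bounces, the distance to the next hyperface becomes `1`. -/
lemma distToFace_neg {x v : ℝ} (hv : v ≠ 0) : distToFace x (-v) = 1 - distToFace x v := by
  unfold distToFace
  rcases lt_or_gt_of_ne hv with h | h
  · simp [h, not_lt.2 h.le]
  · simp [h, not_lt.2 h.le]

/-- In a billiard word, the `k`-th letter `i` is scheduled at time `(ρ i + k) / |θ i|`, where `ρ i`
is the initial distance to the hyperface: at each step the letter is the one that is scheduled
first. -/
lemma IsBilliardWord.exists_schedule {θ x : Fin d → ℝ} {w : ℕ → Fin d} (hx : x ∈ unitCube d)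
    (h : IsBilliardWord θ x w) :
    ∃ (r : Equiv.Perm (Fin d)) (ρ : Fin d → ℝ), (∀ i, 0 ≤ ρ i ∧ ρ i ≤ 1) ∧
      ∀ n, θ (w n) ≠ 0 ∧ ∃ τ : ℝ, ρ (w n) + Nat.count (w · = w n) n = |θ (w n)| * τ ∧
        ∀ j, θ j ≠ 0 → |θ j| * τ ≤ ρ j + Nat.count (w · = j) n ∧
          (|θ j| * τ = ρ j + Nat.count (w · = j) n → r (w n) ≤ r j) := by
  obtain ⟨r, p, v, s, hp0, hv0, hstep⟩ := h
  refine ⟨r, fun i => distToFace (x i) (θ i), fun i =>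
    ⟨distToFace_nonneg hx _ i, distToFace_le_one hx _ i⟩, ?_⟩
  have habs : ∀ n i, |v n i| = |θ i| := by
    intro n i
    induction n with
    | zero => rw [hv0]
    | succ n ih =>
      obtain ⟨-, -, -, -, -, hv⟩ := hstep n
      rw [hv, ← ih]
      by_cases hi : i = w n
      · subst hi; simp
      · simp [Function.update_of_ne hi]
  have hmove : ∀ n i, distToFace (p (n + 1) i) (v n i) =
      distToFace (p n i) (v n i) - s n * |θ i| := by
    intro n i
    obtain ⟨-, hp, -⟩ := hstep n
    rw [hp, ← habs n i, ← distToFace_add_mul]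
    simp
  have hdist : ∀ n i, θ i ≠ 0 → distToFace (p n i) (v n i) =
      distToFace (x i) (θ i) + Nat.count (w · = i) n - |θ i| * ∑ k ∈ Finset.range n, s k := by
    intro n i hi
    induction n with
    | zero => simp [hp0, hv0]
    | succ n ih =>
      obtain ⟨-, -, -, hhit, -, hv⟩ := hstep n
      have hm := hmove n i
      rw [ih] at hm
      rw [Nat.count_succ, Finset.sum_range_succ, hv]
      by_cases hiw : w n = i
      · subst hiw
        rw [hits_iff] at hhit
        rw [hhit.2] at hm
        rw [Function.update_self, distToFace_neg hhit.1, hhit.2, if_pos rfl]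
        push_cast
        linarith
      · rw [Function.update_of_ne (Ne.symm hiw), if_neg hiw, hm]
        push_cast
        ring
  intro n
  obtain ⟨-, -, hcube, hhit, hmin, -⟩ := hstep n
  have hθ : ∀ j, v n j ≠ 0 ↔ θ j ≠ 0 := fun j => by rw [← abs_ne_zero, habs, abs_ne_zero]
  have hhit' := hits_iff.1 hhit
  have hwn := (hθ _).1 hhit'.1
  have hrem : ∀ j, θ j ≠ 0 → distToFace (p (n + 1) j) (v n j) = distToFace (x j) (θ j) +
      Nat.count (w · = j) n - |θ j| * ∑ k ∈ Finset.range (n + 1), s k := by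
    intro j hj
    rw [hmove, hdist n j hj, Finset.sum_range_succ]
    ring
  refine ⟨hwn, ∑ k ∈ Finset.range (n + 1), s k, ?_, fun j hj => ⟨?_, fun heq => ?_⟩⟩
  · have := hrem _ hwn
    rw [hhit'.2] at this
    linarith
  · have := hrem j hj
    have := distToFace_nonneg hcube (v n j) j
    linarith
  · refine hmin j (hits_iff.2 ⟨(hθ j).2 hj, ?_⟩)
    rw [hrem j hj]
    linarith

/-- The case of billiard words. -/
theorem kBinomialComplexity_eq_of_isBilliardWord {θ x : Fin d → ℝ} {w : ℕ → Fin d}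
    (hx : x ∈ unitCube d) (h : IsBilliardWord θ x w) :
    kBinomialComplexity 2 w = subwordComplexity w := by
  obtain ⟨r, ρ, hρ, hsched⟩ := h.exists_schedule hx
  refine kBinomialComplexity_eq_of_pairBalanced fun i j hij => ?_
  have hzero : ∀ i, θ i = 0 → ∀ n, Nat.count (w · = i) n = 0 := fun i hi n => by
    rw [Nat.count_eq_card_filter_range, Finset.card_eq_zero, Finset.filter_eq_empty_iff]
    rintro k - rfl
    exact (hsched k).1 hi
  by_cases hi0 : θ i = 0
  · intro p p' q q' _ _ h1 _
    simp [hzero i hi0] at h1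
  by_cases hj0 : θ j = 0
  · intro p p' q q' _ _ _ h2
    simp [hzero j hj0] at h2
  have key : ∀ i j, θ i ≠ 0 → θ j ≠ 0 → ∀ n, w n = i →
      ρ i / |θ i| + Nat.count (w · = i) n * (1 / |θ i|) ≤
        ρ j / |θ j| + Nat.count (w · = j) n * (1 / |θ j|) ∧
      (ρ i / |θ i| + Nat.count (w · = i) n * (1 / |θ i|) =
        ρ j / |θ j| + Nat.count (w · = j) n * (1 / |θ j|) → r i ≤ r j) := by
    rintro i j hi hj n rfl
    obtain ⟨-, τ, hτ, hτ'⟩ := hsched n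
    obtain ⟨h1, h2⟩ := hτ' j hj
    have hi := abs_pos.2 hi
    have hj := abs_pos.2 hj
    have e1 : ρ (w n) / |θ (w n)| + Nat.count (w · = w n) n * (1 / |θ (w n)|) = τ := by
      field_simp
      linarith
    have e2 : ρ j / |θ j| + Nat.count (w · = j) n * (1 / |θ j|) =
        (ρ j + Nat.count (w · = j) n) / |θ j| := by
      ring
    rw [e1, e2, le_div_iff₀ hj, eq_div_iff hj.ne', mul_comm τ]
    exact ⟨h1, h2⟩
  have hb : ∀ i, ρ i / |θ i| ≤ 1 / |θ i| := fun i =>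
    div_le_div_of_nonneg_right (hρ i).2 (abs_nonneg _)
  exact pairBalanced_of_merge (a := fun i => ρ i / |θ i|) (b := fun i => 1 / |θ i|)
    (le := fun i j => r i ≤ r j) (fun hle => hij (r.injective (le_antisymm hle.1 hle.2)))
    (div_nonneg (hρ i).1 (abs_nonneg _)) (div_nonneg (hρ j).1 (abs_nonneg _)) (hb i) (hb j)
    (key i j hi0 hj0) (key j i hj0 hi0)

end Billiard

/-! ### Colorings -/

section Coloring

lemma countBalanced_of_isBalanced {A : Type*} [DecidableEq A] {w : ℕ → A} (h : IsBalanced 1 w)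
    (i : A) : CountBalanced w i := by
  intro p q n
  have := h n _ ⟨p, rfl⟩ _ ⟨q, rfl⟩ i
  rw [abs_le] at this
  have h1 := count_factorAt w i p n
  have h2 := count_factorAt w i q n
  push_cast at this
  omega

/-- A word is determined by its projection to the letters of `S` together with the numbers of each
other letter in its prefixes. -/
lemma eq_of_count_take_eq_of_filter_eq {C : Type*} [DecidableEq C] (S : Finset C) {u v : List C}
    (hlen : u.length = v.length) (hc : ∀ c ∉ S, ∀ k, (u.take k).count c = (v.take k).count c)
    (hS : u.filter (· ∈ S) = v.filter (· ∈ S)) : u = v := by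
  induction u generalizing v with
  | nil => exact (List.length_eq_zero_iff.1 hlen.symm).symm
  | cons c u ih =>
    cases v with
    | nil => simp at hlen
    | cons c' v =>
      obtain rfl : c = c' := by
        by_contra hne
        by_cases h : c ∈ S
        · by_cases h' : c' ∈ S
          · simp [h, h', hne] at hS
          · have := hc c' h' 1
            simp [hne] at this
        · have := hc c h 1
          simp [Ne.symm hne] at this
      congr 1
      refine ih (by simpa using hlen) (fun b hb k => ?_) ?_
      · have := hc b hb (k + 1)
        simpa [List.count_cons] using this
      · by_cases h : c ∈ S <;> simpa [h] using hS

variable {A B : Type*} [DecidableEq A] [DecidableEq B] (w₀ : ℕ → A) (a : A) (w₁ : ℕ → B)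

lemma count_color_inl (b : {b : A // b ≠ a}) (n : ℕ) :
    Nat.count (color w₀ a w₁ · = Sum.inl b) n = Nat.count (w₀ · = b) n := by
  induction n with
  | zero => simp
  | succ n ih =>
    rw [Nat.count_succ, Nat.count_succ, ih]
    congr 2
    unfold color
    split_ifs with h
    · simp [h, b.2.symm]
    · simp [Subtype.ext_iff]

lemma count_color_inr (b : B) (n : ℕ) :
    Nat.count (color w₀ a w₁ · = Sum.inr b) n =
      Nat.count (w₁ · = b) (Nat.count (w₀ · = a) n) := by
  induction n with
  | zero => simp
  | succ n ih =>
    rw [Nat.count_succ, Nat.count_succ (w₀ · = a), ih]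
    by_cases h : w₀ n = a
    · rw [if_pos h, Nat.count_succ]
      simp [color, h]
    · simp [color, h]

lemma length_filter_color [Fintype B] (p n : ℕ) :
    Nat.count (w₀ · = a) (p + n) = Nat.count (w₀ · = a) p + ((factorAt (color w₀ a w₁) p n).filter
      (· ∈ Finset.univ.image (Sum.inr : B → {b : A // b ≠ a} ⊕ B))).length := by
  induction n with
  | zero => simp [factorAt]
  | succ n ih =>
    rw [← add_assoc, Nat.count_succ, ih, factorAt_succ, List.filter_append, List.length_append,
      add_assoc]
    congr 2
    by_cases h : w₀ (p + n) = a <;> simp [color, h]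

/-- The case of colorings: the balance of `w₀` determines the letters of `w₀` other than `a` in a
factor, and the balance of `w₁` determines the word formed by the other letters. -/
theorem kBinomialComplexity_color_eq [Fintype A] [Fintype B] (h₀ : IsBalanced 1 w₀)
    (h₁ : IsBalanced 1 w₁) :
    kBinomialComplexity 2 (color w₀ a w₁) = subwordComplexity (color w₀ a w₁) := by
  refine kBinomialComplexity_eq _ fun p q n hbin =>
    eq_of_count_take_eq_of_filter_eq (Finset.univ.image Sum.inr) (by simp [length_factorAt])
      (fun c hc k => ?_) ?_
  · obtain ⟨b, rfl⟩ : ∃ b, c = Sum.inl b := by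
      rcases c with b | b
      · exact ⟨b, rfl⟩
      · simp at hc
    have := count_take_filter_eq_of_binom_eq Finset.univ hbin (i := Sum.inl b) (by simp)
      (fun u' v' hu hv hlen => ?_) k
    · simpa using this
    · obtain ⟨p', hp'⟩ := exists_of_infix_factorAt hu
      obtain ⟨q', hq'⟩ := exists_of_infix_factorAt hv
      simp only [Finset.mem_univ, decide_true, List.filter_true] at hlen
      have c1 := count_factorAt (color w₀ a w₁) (Sum.inl b) p' u'.length
      have c2 := count_factorAt (color w₀ a w₁) (Sum.inl b) q' v'.length
      rw [← hp', count_color_inl, count_color_inl] at c1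
      rw [← hq', count_color_inl, count_color_inl] at c2
      have e1 := countBalanced_of_isBalanced h₀ b p' q' u'.length
      have e2 := countBalanced_of_isBalanced h₀ b q' p' u'.length
      rw [← hlen] at c2
      rw [abs_le]
      omega
  · refine filter_eq_of_binom_eq _ hbin fun i hi u' v' hu hv hlen => ?_
    obtain ⟨b, -, rfl⟩ := Finset.mem_image.1 hi
    obtain ⟨p', hp'⟩ := exists_of_infix_factorAt hu
    obtain ⟨q', hq'⟩ := exists_of_infix_factorAt hv
    have c1 := count_factorAt (color w₀ a w₁) (Sum.inr b) p' u'.length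
    have c2 := count_factorAt (color w₀ a w₁) (Sum.inr b) q' v'.length
    have l1 := length_filter_color w₀ a w₁ p' u'.length
    have l2 := length_filter_color w₀ a w₁ q' v'.length
    rw [← hp'] at c1 l1
    rw [← hq'] at c2 l2
    rw [count_color_inr, count_color_inr, l1] at c1
    rw [count_color_inr, count_color_inr, l2, ← hlen] at c2
    have e1 := countBalanced_of_isBalanced h₁ b (Nat.count (w₀ · = a) p')
      (Nat.count (w₀ · = a) q') (u'.filter (· ∈ Finset.univ.image Sum.inr)).length
    have e2 := countBalanced_of_isBalanced h₁ b (Nat.count (w₀ · = a) q')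
      (Nat.count (w₀ · = a) p') (u'.filter (· ∈ Finset.univ.image Sum.inr)).length
    rw [abs_le]
    omega

end Coloring

end WordComb

theorem theorem1 (d : ℕ) (hd : 2 ≤ d) :
    (∀ (A : Type u) [Fintype A] [DecidableEq A], Fintype.card A = d →
      ∀ w : ℕ → A, WordComb.IsBalanced 1 w →
        WordComb.kBinomialComplexity 2 w = WordComb.subwordComplexity w) ∧
    (∀ (A : Type u) [Fintype A] [DecidableEq A] (w : ℕ → A),
      (∀ n : ℕ, 0 < n → WordComb.subwordComplexity w n = n + (d - 1)) →
        WordComb.kBinomialComplexity 2 w = WordComb.subwordComplexity w) ∧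
    (∀ θ x : Fin d → ℝ, x ∈ WordComb.unitCube d →
      ∀ w : ℕ → Fin d, WordComb.IsBilliardWord θ x w →
        WordComb.kBinomialComplexity 2 w = WordComb.subwordComplexity w) ∧
    (∀ (A : Type u) (B : Type v) [Fintype A] [DecidableEq A] [Fintype B] [DecidableEq B]
      (w₀ : ℕ → A) (a : A) (w₁ : ℕ → B),
      WordComb.IsSturmian w₀ → WordComb.IsSturmian w₁ →
        WordComb.kBinomialComplexity 2 (WordComb.color w₀ a w₁) =
          WordComb.subwordComplexity (WordComb.color w₀ a w₁)) := by
  refine ⟨fun A _ _ _ w h => WordComb.kBinomialComplexity_eq_of_isBalanced h,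
    fun A _ _ w h => WordComb.kBinomialComplexity_eq_of_subwordComplexity (by omega) h,
    fun θ x hx w h => WordComb.kBinomialComplexity_eq_of_isBilliardWord hx h,
    fun A B _ _ _ _ w₀ a w₁ h₀ h₁ => WordComb.kBinomialComplexity_color_eq w₀ a w₁
      (WordComb.isBalanced_of_isSturmian h₀) (WordComb.isBalanced_of_isSturmian h₁)⟩
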